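/- Fix an integer $p\ge 2$. For $N\ge 1$ let $\mathbf X=(X_1,\dots,X_N)\in\{-1,1\}^N$ have the $p$-spin Curie–Weiss law $$\mathbb P_\beta(\mathbf X=\mathbf x)=\frac{e^{\beta H_N(\mathbf x)}}{\sum_{\mathbf y\in\{-1,1\}^N}e^{\beta H_N(\mathbf y)}},\qquad H_N(\mathbf x)=\sum_{1\le i_1,\dots,i_p\le N}J_{i_1\dots i_p}x_{i_1}\cdots x_{i_p},\qquad J_{i_1\dots i_p}=\frac1{N^{p-1}}.$$ With $m_i(\mathbf x)=\sum_{i_2,\dots,i_p}J_{i i_2\dots i_p}x_{i_2}\cdots x_{i_p}$, the maximum pseudo-likelihood estimate is $$\hat\beta_N=\hat\beta_N(\mathbf X)=\inf\Big\{b\ge 0: H_N(\mathbf X)=\sum_{i=1}^N m_i(\mathbf X)\tanh\big(p\,b\,m_i(\mathbf X)\big)\Big\}\in[0,\infty],\qquad \inf\emptyset=+\infty.$$ Let $I(t)=\frac12\{(1+t)\log(1+t)+(1-t)\log(1-t)\}$ for $t\in[-1,1]$ (with $0\log 0=0$), and let $$\beta^*_{\mathrm{CW}}(p)=\sup\Big\{\beta\ge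 0:\sup_{t\in[0,1]}\{\beta t^p-I(t)\}=0\Big\}.$$ Suppose $\beta=\beta^*_{\mathrm{CW}}(p)$ and put $g(t)=\beta t^p-I(t)$ for $t\in[-1,1]$. Convergence in distribution is understood for random variables with values in the extended real line $[-\infty,\infty]$. As $N\to\infty$ the following hold. (1) If $p=2$, then $\beta^*_{\mathrm{CW}}(2)=\frac12$ and, for every $t\in\mathbb R$, $$\lim_{N\to\infty}\mathbb P_\beta\Big(N^{1/2}\big(\hat\beta_N-\tfrac12\big)\le t\Big)=\begin{cases}F(\sqrt{6t})-F(-\sqrt{6t})&\text{if } t\ge 0,\\ 0&\text{if } t<0,\end{cases}$$ where $F$ is the probability distribution function with density proportional to $\exp(-t^4/12)$. Now let $p\ge 3$. Then $g$ has a unique positive global maximizer $m_*$ on $[-1,1]$; it satisfies $m_*\in(0,1)$ and $g''(m_*)<0$. Define $$\alpha=\begin{cases}\dfrac1{1+2\,[(m_*^2-1)g''(m_*)]^{-1/2}}&\text{if } p \text{ is even},\\[2ex]\dfrac1{1+[(m_*^2-1)g''(m_*)]^{-1/2}}&\text{if } p\text{ is odd}.\end{cases}$$ (2) If $p\ge 3$,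 then $$\sqrt N(\hat\beta_N-\beta)\xrightarrow{D}(1-\alpha)\,N\Big(0,-\frac{g''(m_*)}{p^2m_*^{2p-2}}\Big)+\alpha\,\delta_\infty .$$ (3) Let $Z\sim N(0,1)$, and write $\mathcal L(Y)$ for the law of $Y$. (a) If $p\ge 4$ is even, then $$N^{1-\frac p2}\hat\beta_N\xrightarrow{D}\alpha\,\mathcal L\Big(\frac1{pZ^{p-2}}\Big)+(1-\alpha)\,\delta_0 .$$ (b) If $p\ge 3$ is odd, then $$N^{1-\frac p2}\hat\beta_N\xrightarrow{D}\frac\alpha2\,\mathcal L\Big(\frac1{p|Z|^{p-2}}\Big)+\frac\alpha2\,\delta_\infty+(1-\alpha)\,\delta_0 .$$ -/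

import Mathlib

open MeasureTheory ProbabilityTheory Filter Topology
open scoped ENNReal BigOperators

noncomputable section

/-- Spin configurations in `{-1, 1}^N`; the unit group `ℤˣ` is exactly `{-1, 1}`. -/
abbrev SpinConfig (N : ℕ) : Type := Fin N → ℤˣ

/-- The spin `x_i` as a real number. -/
def spin {N : ℕ} (x : SpinConfig N) (i : Fin N) : ℝ := ((x i : ℤ) : ℝ)

/-- A `p`-tensor `(J_{i_1 … i_p})` with indices in `[N]`. -/
abbrev InteractionTensor (p N : ℕ) : Type := (Fin p → Fin N) → ℝ

/-- `H_N(x) = ∑_{i_1, …, i_p} J_{i_1 … i_p} x_{i_1} ⋯ x_{i_p}`. -/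
def hamiltonian {p N : ℕ} (J : InteractionTensor p N) (x : SpinConfig N) : ℝ :=
  ∑ j : Fin p → Fin N, J j * ∏ k : Fin p, spin x (j k)

/-- `Z_N(β) = 2^{-N} ∑_x exp (β H_N(x))`. -/
def partitionFunction {p N : ℕ} (J : InteractionTensor p N) (β : ℝ) : ℝ :=
  1 / 2 ^ N * ∑ x : SpinConfig N, Real.exp (β * hamiltonian J x)

/-- The probability mass function `exp (β H_N(x)) / (2^N Z_N(β))`. -/
def isingPMF {p N : ℕ} (J : InteractionTensor p N) (β : ℝ) (x : SpinConfig N) : ℝ :=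
  1 / (2 ^ N * partitionFunction J β) * Real.exp (β * hamiltonian J x)

/-- The `p`-tensor Ising model `ℙ_β`, as a measure on `{-1, 1}^N`. -/
def isingMeasure {p N : ℕ} (J : InteractionTensor p N) (β : ℝ) : Measure (SpinConfig N) :=
  ∑ x : SpinConfig N, ENNReal.ofReal (isingPMF J β x) • Measure.dirac x

lemma sum_isingPMF {p N : ℕ} (J : InteractionTensor p N) (β : ℝ) :
    ∑ x : SpinConfig N, isingPMF J β x = 1 := by
  have h : 0 < ∑ x : SpinConfig N, Real.exp (β * hamiltonian J x) :=
    Finset.sum_pos (fun _ _ => Real.exp_pos _) Finset.univ_nonempty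
  unfold isingPMF partitionFunction
  rw [← Finset.mul_sum]
  field_simp

lemma isingPMF_nonneg {p N : ℕ} (J : InteractionTensor p N) (β : ℝ) (x : SpinConfig N) :
    0 ≤ isingPMF J β x := by
  unfold isingPMF partitionFunction
  positivity

instance isProbabilityMeasure_isingMeasure {p N : ℕ} (J : InteractionTensor p N) (β : ℝ) :
    IsProbabilityMeasure (isingMeasure J β) := by
  constructor
  simp only [isingMeasure, Measure.coe_finsetSum, Finset.sum_apply, Measure.smul_apply,
    measure_univ, smul_eq_mul, mul_one]
  rw [← ENNReal.ofReal_sum_of_nonneg (fun x _ => isingPMF_nonneg J β x), sum_isingPMF,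
    ENNReal.ofReal_one]

/-- The local magnetization
`m_i(x) = ∑_{i_2, …, i_p} J_{i i_2 … i_p} x_{i_2} ⋯ x_{i_p}`: the sum is over the index tuples
whose first entry is `i`, and the product over the entries other than the first. -/
def localField {p N : ℕ} (J : InteractionTensor p N) (x : SpinConfig N) (i : Fin N) : ℝ :=
  ∑ j : Fin p → Fin N with ∀ k : Fin p, (k : ℕ) = 0 → j k = i,
    J j * ∏ k ∈ Finset.univ.filter (fun k : Fin p => (k : ℕ) ≠ 0), spin x (j k)

/-- The maximum pseudo-likelihood estimate
`inf {b ≥ 0 : H_N(x) = ∑_i m_i(x) tanh (p b m_i(x))} ∈ [0, ∞]`. The infimum is taken in the extended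
reals, so that it is `∞` for the empty set. -/
def mplEstimate {p N : ℕ} (J : InteractionTensor p N) (x : SpinConfig N) : EReal :=
  sInf ((fun b : ℝ => (b : EReal)) '' {b : ℝ | 0 ≤ b ∧
    hamiltonian J x = ∑ i : Fin N, localField J x i * Real.tanh (p * b * localField J x i)})

/-- The Curie–Weiss tensor, all of whose entries are `1 / N^{p-1}`. -/
def curieWeissTensor (p N : ℕ) : InteractionTensor p N := fun _ => 1 / (N : ℝ) ^ (p - 1)

/-- `I(t) = ((1+t) log (1+t) + (1-t) log (1-t)) / 2`. -/
def binaryEntropy (t : ℝ) : ℝ :=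
  1 / 2 * ((1 + t) * Real.log (1 + t) + (1 - t) * Real.log (1 - t))

/-- `g(t) = β t^p - I(t)`. -/
def curieWeissG (p : ℕ) (β t : ℝ) : ℝ := β * t ^ p - binaryEntropy t

/-- `β*_CW(p) = sup {β ≥ 0 : sup_{t ∈ [0,1]} (β t^p - I(t)) = 0}`. -/
def curieWeissThreshold (p : ℕ) : ℝ :=
  sSup {β : ℝ | 0 ≤ β ∧ sSup (curieWeissG p β '' Set.Icc 0 1) = 0}

/-- `m` is positive and maximizes `g` over `[-1, 1]`. -/
def IsPositiveMaximizer (p : ℕ) (β m : ℝ) : Prop :=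
  0 < m ∧ m ≤ 1 ∧ ∀ t ∈ Set.Icc (-1 : ℝ) 1, curieWeissG p β t ≤ curieWeissG p β m

/-- The Curie–Weiss model `ℙ_β` at the threshold `β = β*_CW(p)`. -/
abbrev thresholdMeasure (p N : ℕ) : Measure (SpinConfig N) :=
  isingMeasure (curieWeissTensor p N) (curieWeissThreshold p)

/-- `g''(m)` at `β = β*_CW(p)`. -/
def thresholdCurvature (p : ℕ) (m : ℝ) : ℝ :=
  deriv (deriv (curieWeissG p (curieWeissThreshold p))) m

/-- The mixture proportion `α`. -/
def mixtureWeight (p : ℕ) (m : ℝ) : ℝ :=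
  if Even p then 1 / (1 + 2 * ((m ^ 2 - 1) * thresholdCurvature p m) ^ (-(1 / 2) : ℝ))
  else 1 / (1 + ((m ^ 2 - 1) * thresholdCurvature p m) ^ (-(1 / 2) : ℝ))

/-- The distribution function with density proportional to `exp (-t^4 / 12)`. -/
def quarticCDF (x : ℝ) : ℝ :=
  (∫ t in Set.Iic x, Real.exp (-t ^ 4 / 12)) / ∫ t : ℝ, Real.exp (-t ^ 4 / 12)

/-- `(1 - α) N(0, -g''(m) / (p² m^{2p-2})) + α δ_∞`, a measure on the extended reals. -/
def sqrtScaleLimit (p : ℕ) (m : ℝ) : Measure EReal :=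
  ENNReal.ofReal (1 - mixtureWeight p m) •
      (gaussianReal 0 (-thresholdCurvature p m / ((p : ℝ) ^ 2 * m ^ (2 * p - 2))).toNNReal).map
        (fun y : ℝ => (y : EReal)) +
    ENNReal.ofReal (mixtureWeight p m) • Measure.dirac ⊤

/-- `α · law(1 / (p Z^{p-2})) + (1 - α) δ_0` with `Z ∼ N(0, 1)`. -/
def fineScaleLimitEven (p : ℕ) (m : ℝ) : Measure EReal :=
  ENNReal.ofReal (mixtureWeight p m) •
      (gaussianReal 0 1).map (fun z : ℝ => ((1 / (p * z ^ (p - 2)) : ℝ) : EReal)) +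
    ENNReal.ofReal (1 - mixtureWeight p m) • Measure.dirac 0

/-- `(α/2) · law(1 / (p |Z|^{p-2})) + (α/2) δ_∞ + (1 - α) δ_0` with `Z ∼ N(0, 1)`. -/
def fineScaleLimitOdd (p : ℕ) (m : ℝ) : Measure EReal :=
  ENNReal.ofReal (mixtureWeight p m / 2) •
      (gaussianReal 0 1).map (fun z : ℝ => ((1 / (p * |z| ^ (p - 2)) : ℝ) : EReal)) +
    ENNReal.ofReal (mixtureWeight p m / 2) • Measure.dirac ⊤ +
    ENNReal.ofReal (1 - mixtureWeight p m) • Measure.dirac 0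

lemma rpow_neg_half_nonneg (x : ℝ) : 0 ≤ x ^ (-(1 / 2) : ℝ) := by
  rcases le_or_gt 0 x with h | h
  · exact Real.rpow_nonneg h _
  · rw [Real.rpow_def_of_neg h, show (-(1 / 2) : ℝ) * Real.pi = -(Real.pi / 2) by ring,
      Real.cos_neg, Real.cos_pi_div_two, mul_zero]

lemma mixtureWeight_nonneg (p : ℕ) (m : ℝ) : 0 ≤ mixtureWeight p m := by
  have h := rpow_neg_half_nonneg ((m ^ 2 - 1) * thresholdCurvature p m)
  unfold mixtureWeight
  split_ifs <;> positivity

lemma mixtureWeight_le_one (p : ℕ) (m : ℝ) : mixtureWeight p m ≤ 1 := by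
  have h := rpow_neg_half_nonneg ((m ^ 2 - 1) * thresholdCurvature p m)
  unfold mixtureWeight
  split_ifs
  · exact div_le_one_of_le₀ (by linarith) (by linarith)
  · exact div_le_one_of_le₀ (by linarith) (by linarith)

instance isProbabilityMeasure_sqrtScaleLimit (p : ℕ) (m : ℝ) :
    IsProbabilityMeasure (sqrtScaleLimit p m) := by
  have h0 := mixtureWeight_nonneg p m
  have h1 := mixtureWeight_le_one p m
  constructor
  rw [sqrtScaleLimit, Measure.add_apply, Measure.smul_apply, Measure.smul_apply,
    Measure.map_apply measurable_coe_real_ereal MeasurableSet.univ, Set.preimage_univ,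
    measure_univ, measure_univ, smul_eq_mul, smul_eq_mul, mul_one, mul_one,
    ← ENNReal.ofReal_add (by linarith) h0, sub_add_cancel, ENNReal.ofReal_one]

instance isProbabilityMeasure_fineScaleLimitEven (p : ℕ) (m : ℝ) :
    IsProbabilityMeasure (fineScaleLimitEven p m) := by
  have h0 := mixtureWeight_nonneg p m
  have h1 := mixtureWeight_le_one p m
  constructor
  rw [fineScaleLimitEven, Measure.add_apply, Measure.smul_apply, Measure.smul_apply,
    Measure.map_apply (by fun_prop) MeasurableSet.univ, Set.preimage_univ,
    measure_univ, measure_univ, smul_eq_mul, smul_eq_mul, mul_one, mul_one,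
    ← ENNReal.ofReal_add h0 (by linarith), add_sub_cancel, ENNReal.ofReal_one]

instance isProbabilityMeasure_fineScaleLimitOdd (p : ℕ) (m : ℝ) :
    IsProbabilityMeasure (fineScaleLimitOdd p m) := by
  have h0 := mixtureWeight_nonneg p m
  have h1 := mixtureWeight_le_one p m
  constructor
  rw [fineScaleLimitOdd, Measure.add_apply, Measure.add_apply, Measure.smul_apply,
    Measure.smul_apply, Measure.smul_apply,
    Measure.map_apply (by fun_prop) MeasurableSet.univ, Set.preimage_univ,
    measure_univ, measure_univ, measure_univ]
  simp only [smul_eq_mul, mul_one]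
  rw [← ENNReal.ofReal_add (by linarith) (by linarith),
    ← ENNReal.ofReal_add (by linarith) (by linarith), add_halves, add_sub_cancel,
    ENNReal.ofReal_one]

end

/-! In the Curie–Weiss model everything depends on the mean spin `t`: the Hamiltonian is `N t^p` and
every local field is `t^(p-1)`. For `t ≠ 0` the pseudo-likelihood equation becomes `tanh (p b
t^(p-1)) = t`, so the estimate is `η(t) = artanh t / (p t^(p-1))` when `|t| < 1` and this is
nonnegative, and `∞` otherwise; at `t = 0` it is `0` (`mplEstimate_curieWeissTensor`). What remains
is the law of `t` at the threshold.

By Stirling, the weight of a lattice value `t` is `exp (N g(t))` times an explicit prefactor, and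
Laplace's method (`tendsto_sum_spinWeight`) localizes sums of weights at the zeros of `g ≤ 0`. A
zero `c` with `g(t) ~ -κ (t - c)^q` contributes fluctuations `z` of scale `N^(-1/q)` with density
proportional to `exp (-κ z^q)`. Test functions need only converge along `c + z / s N` jointly in `N`
and `z`, for almost every `z`, so indicators and the singularity of `η` at `0` are allowed.

For `p = 2` the only zero is `0`, where `g(t) ~ -t^4 / 12`; since `η(t) - 1/2 ~ t^2 / 6`, the limit
is the law of `z^2 / 6`.

For `p ≥ 3` the zeros are `0`, `m` and, for even `p`, `-m`. All are quadratic, with masses in the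
ratio `1 : A`, `A = ((m^2 - 1) g''(m))^(-1/2)`, which gives `α` (`tendsto_integral_threshold`). Near
`0`, `η(t) ~ 1 / (p t^(p-2))` is of order `N^(p/2-1)`, or the estimate is `∞` when `p` is odd and `t
< 0`; near `m` the delta method applies, as `η(m) = β` and `η'(m) = -g''(m) / (p m^(p-1))`.
Uniqueness of `m` and `g''(m) < 0` come from counting zeros of `t I'(t) - p I(t)` by Rolle's
theorem. -/

noncomputable section

/-! ### Spin weights: entropy bound and Stirling form -/

/-- The magnetization of a configuration of `N` spins, `k` of which are `+1`. -/
def magnetization (N k : ℕ) : ℝ := (2 * k - N) / N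

/-- The unnormalized mass of `k` positive spins in the Curie–Weiss model. -/
def spinWeight (p : ℕ) (β : ℝ) (N k : ℕ) : ℝ :=
  (N.choose k : ℝ) / 2 ^ N * Real.exp (β * (N * magnetization N k ^ p))

lemma spinWeight_nonneg (p : ℕ) (β : ℝ) (N k : ℕ) : 0 ≤ spinWeight p β N k := by
  unfold spinWeight; positivity

lemma one_add_magnetization {N k : ℕ} (hN : 0 < N) : 1 + magnetization N k = k * (2 / N) := by
  unfold magnetization; field_simp; ring

lemma one_sub_magnetization {N k : ℕ} (hN : 0 < N) (hk : k ≤ N) :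
    1 - magnetization N k = (N - k : ℕ) * (2 / N) := by
  unfold magnetization; push_cast [hk]; field_simp; ring

lemma magnetization_mem_Icc {N k : ℕ} (hN : 0 < N) (hk : k ≤ N) :
    magnetization N k ∈ Set.Icc (-1 : ℝ) 1 := by
  have h1 := one_add_magnetization (k := k) hN
  have h2 := one_sub_magnetization hN hk
  have h3 : (0 : ℝ) ≤ k * (2 / N) := by positivity
  have h4 : (0 : ℝ) ≤ (N - k : ℕ) * (2 / N) := by positivity
  constructor <;> linarith

lemma exp_natCast_mul_log {k : ℕ} {a : ℝ} (ha : 0 < a) :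
    Real.exp (k * Real.log (k * a)) = (k * a) ^ k := by
  rcases Nat.eq_zero_or_pos k with rfl | hk
  · simp
  · rw [Real.exp_nat_mul, Real.exp_log (by positivity)]

lemma exp_mul_binaryEntropy {N k : ℕ} (hN : 0 < N) (hk : k ≤ N) :
    Real.exp (N * binaryEntropy (magnetization N k)) =
      (k * (2 / N : ℝ)) ^ k * ((N - k : ℕ) * (2 / N : ℝ)) ^ (N - k) := by
  have hN' : (0 : ℝ) < 2 / N := by positivity
  rw [← exp_natCast_mul_log hN', ← exp_natCast_mul_log hN', ← Real.exp_add, binaryEntropy,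
    one_add_magnetization hN, one_sub_magnetization hN hk]
  congr 1
  field_simp

/-- A single term of the binomial expansion of `(k/N + (N-k)/N)^N = 1` is at most `1`. Unlike the
Stirling form this includes `k = 0` and `k = N`, so it serves for the tails. -/
lemma choose_div_two_pow_le {N k : ℕ} (hN : 0 < N) (hk : k ≤ N) :
    (N.choose k : ℝ) / 2 ^ N ≤ Real.exp (-(N * binaryEntropy (magnetization N k))) := by
  have hNR : (0 : ℝ) < N := by positivity
  rw [Real.exp_neg, exp_mul_binaryEntropy hN hk, ← one_div, le_div_iff₀]
  · have h := add_pow ((k : ℝ) / N) ((N - k : ℕ) / N) N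
    have h1 : (k : ℝ) / N + (N - k : ℕ) / N = 1 := by
      push_cast [hk]; field_simp; ring
    rw [h1, one_pow] at h
    calc (N.choose k : ℝ) / 2 ^ N *
          ((k * (2 / N : ℝ)) ^ k * ((N - k : ℕ) * (2 / N : ℝ)) ^ (N - k))
        = ((k : ℝ) / N) ^ k * ((N - k : ℕ) / N) ^ (N - k) * N.choose k := by
          have e1 : (k * (2 / N : ℝ)) ^ k = 2 ^ k * ((k : ℝ) / N) ^ k := by
            rw [← mul_pow]; congr 1; ring
          have e2 : ((N - k : ℕ) * (2 / N : ℝ)) ^ (N - k) =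
              2 ^ (N - k) * (((N - k : ℕ) : ℝ) / N) ^ (N - k) := by
            rw [← mul_pow]; congr 1; ring
          have e3 : (2 : ℝ) ^ N = 2 ^ k * 2 ^ (N - k) := by rw [← pow_add]; congr 1; omega
          rw [e1, e2, e3]; field_simp
      _ ≤ 1 := by
          rw [h]
          exact Finset.single_le_sum
            (f := fun m => ((k : ℝ) / N) ^ m * (((N - k : ℕ) : ℝ) / N) ^ (N - m) * N.choose m)
            (fun i _ => by positivity) (Finset.mem_range.2 (by omega))
  · rw [← exp_mul_binaryEntropy hN hk]; exact Real.exp_pos _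

lemma spinWeight_le (p : ℕ) (β : ℝ) {N k : ℕ} (hN : 0 < N) (hk : k ≤ N) :
    spinWeight p β N k ≤ Real.exp (N * curieWeissG p β (magnetization N k)) := by
  have h := mul_le_mul_of_nonneg_right (choose_div_two_pow_le hN hk)
    (Real.exp_pos (β * (N * magnetization N k ^ p))).le
  rw [← Real.exp_add] at h
  refine h.trans (le_of_eq ?_)
  rw [curieWeissG]; congr 1; ring

/-- The correction factor in Stirling's approximation of a binomial coefficient. -/
def stirlingRatio (N k : ℕ) : ℝ :=
  Stirling.stirlingSeq N / (Stirling.stirlingSeq k * Stirling.stirlingSeq (N - k))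

lemma factorial_eq_stirlingSeq {n : ℕ} (hn : 0 < n) :
    (n.factorial : ℝ) = Stirling.stirlingSeq n * (√(2 * n) * (n / Real.exp 1) ^ n) := by
  rw [Stirling.stirlingSeq, div_mul_cancel₀]
  positivity

lemma stirlingSeq_pos {n : ℕ} (hn : 0 < n) : 0 < Stirling.stirlingSeq n :=
  lt_of_lt_of_le (Real.sqrt_pos.2 Real.pi_pos) (Stirling.sqrt_pi_le_stirlingSeq hn.ne')

lemma stirlingSeq_le {n : ℕ} : Stirling.stirlingSeq n ≤ Stirling.stirlingSeq 1 := by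
  rcases n with _ | n
  · rw [Stirling.stirlingSeq_zero]; exact (stirlingSeq_pos one_pos).le
  · exact Stirling.stirlingSeq'_antitone (Nat.zero_le n)

lemma stirlingRatio_nonneg (N k : ℕ) : 0 ≤ stirlingRatio N k := by
  have h : ∀ n, 0 ≤ Stirling.stirlingSeq n := fun n => by
    rcases Nat.eq_zero_or_pos n with rfl | hn
    · simp
    · exact (stirlingSeq_pos hn).le
  exact div_nonneg (h _) (mul_nonneg (h _) (h _))

/-- The Stirling sequence decreases from its value at `1` and stays above `√π`. The uniform bound
feeds the domination in Laplace's method. -/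
lemma stirlingRatio_le {N k : ℕ} (hk : 0 < k) (hkN : k < N) :
    stirlingRatio N k ≤ Stirling.stirlingSeq 1 / Real.pi := by
  have h1 := Stirling.sqrt_pi_le_stirlingSeq hk.ne'
  have h2 := Stirling.sqrt_pi_le_stirlingSeq (n := N - k) (by omega)
  have h3 : Real.pi ≤ Stirling.stirlingSeq k * Stirling.stirlingSeq (N - k) := by
    calc Real.pi = √Real.pi * √Real.pi := (Real.mul_self_sqrt Real.pi_pos.le).symm
      _ ≤ _ := mul_le_mul h1 h2 (Real.sqrt_nonneg _) ((Real.sqrt_nonneg _).trans h1)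
  exact div_le_div₀ (stirlingSeq_pos one_pos).le stirlingSeq_le Real.pi_pos h3

lemma tendsto_stirlingRatio {k : ℕ → ℕ} (h1 : Tendsto k atTop atTop)
    (h2 : Tendsto (fun N => N - k N) atTop atTop) :
    Tendsto (fun N => stirlingRatio N (k N)) atTop (𝓝 (1 / √Real.pi)) := by
  have hs := Stirling.tendsto_stirlingSeq_sqrt_pi
  have h0 : √Real.pi ≠ 0 := (Real.sqrt_pos.2 Real.pi_pos).ne'
  have := hs.div ((hs.comp h1).mul (hs.comp h2)) (mul_ne_zero h0 h0)
  rw [div_mul_cancel_left₀ h0, ← one_div] at this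
  exact this

/-- An exact identity: `stirlingRatio` absorbs the whole error of Stirling's formula. The square
root comes from `1 - t^2 = 4 k (N - k) / N^2`. -/
lemma choose_div_two_pow_eq {N k : ℕ} (hk : 0 < k) (hkN : k < N) :
    (N.choose k : ℝ) / 2 ^ N = stirlingRatio N k * √(2 / (N * (1 - magnetization N k ^ 2))) *
      Real.exp (-(N * binaryEntropy (magnetization N k))) := by
  obtain ⟨l, rfl⟩ : ∃ l, N = k + l := ⟨N - k, by omega⟩
  have hl : 0 < l := by omega
  have hN : 0 < k + l := by omega
  have hm : 1 - magnetization (k + l) k ^ 2 = 4 * k * l / ((k + l : ℕ) : ℝ) ^ 2 := by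
    have e1 := one_add_magnetization (k := k) hN
    have e2 := one_sub_magnetization hN hkN.le
    rw [show k + l - k = l by omega] at e2
    calc _ = (1 + magnetization (k + l) k) * (1 - magnetization (k + l) k) := by ring
      _ = _ := by rw [e1, e2]; field_simp; ring
  rw [Real.exp_neg, exp_mul_binaryEntropy hN hkN.le, hm, Nat.cast_add_choose,
    factorial_eq_stirlingSeq hk, factorial_eq_stirlingSeq hl,
    factorial_eq_stirlingSeq hN, stirlingRatio, show k + l - k = l by omega]
  have s1 := stirlingSeq_pos hk
  have s2 := stirlingSeq_pos hl
  have hk' : (0 : ℝ) < k := by positivity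
  have hl' : (0 : ℝ) < l := by positivity
  have hN' : (0 : ℝ) < (k + l : ℕ) := by positivity
  have r1 : √(2 / ((k + l : ℕ) * (4 * k * l / ((k + l : ℕ) : ℝ) ^ 2))) =
      √(2 * (k + l : ℕ)) / (√(2 * k) * √(2 * l)) := by
    rw [← Real.sqrt_mul (by positivity), ← Real.sqrt_div (by positivity)]
    congr 1
    field_simp
    ring
  rw [r1]
  have q1 : 0 < √(2 * (k : ℝ)) := by positivity
  have q2 : 0 < √(2 * (l : ℝ)) := by positivity
  simp only [mul_pow, div_pow, pow_add]
  field_simp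

lemma spinWeight_eq (p : ℕ) (β : ℝ) {N k : ℕ} (hk : 0 < k) (hkN : k < N) :
    spinWeight p β N k = stirlingRatio N k * √(2 / (N * (1 - magnetization N k ^ 2))) *
      Real.exp (N * curieWeissG p β (magnetization N k)) := by
  rw [spinWeight, choose_div_two_pow_eq hk hkN, mul_assoc, ← Real.exp_add, curieWeissG]
  congr 2; ring

/-! ### Sums over lattice points as integrals in the rescaled variable -/

/-- Writing the sum as the integral of a step function lets dominated convergence replace
Riemann-sum estimates. -/
lemma sum_range_eq_integral_floor (a : ℕ → ℝ) (n : ℕ) :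
    ∑ k ∈ Finset.range n, a k =
      ∫ y : ℝ, (Set.Ico (0 : ℝ) n).indicator (fun y => a ⌊y⌋₊) y := by
  have key : ∀ k : ℕ, Set.EqOn (fun y : ℝ => a ⌊y⌋₊) (fun _ => a k) (Set.Ico (k : ℝ) (k + 1)) := by
    intro k y hy
    have : ⌊y⌋₊ = k := (Nat.floor_eq_iff (k.cast_nonneg.trans hy.1)).2 hy
    simp [this]
  rw [integral_indicator measurableSet_Ico, integral_Ico_eq_integral_Ioc,
    ← intervalIntegral.integral_of_le n.cast_nonneg]
  have hi : ∀ k : ℕ, IntervalIntegrable (fun y : ℝ => a ⌊y⌋₊) volume k (k + 1 : ℕ) ∧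
      ∫ y in (k : ℝ)..(k + 1 : ℕ), a ⌊y⌋₊ = a k := by
    intro k
    have hle : (k : ℝ) ≤ (k + 1 : ℕ) := by push_cast; linarith
    constructor
    · rw [intervalIntegrable_iff_integrableOn_Ico_of_le hle]
      push_cast
      exact (integrableOn_const (by simp)).congr_fun (key k).symm measurableSet_Ico
    · rw [intervalIntegral.integral_of_le hle, ← integral_Ico_eq_integral_Ioc]
      push_cast
      rw [setIntegral_congr_fun measurableSet_Ico (key k)]
      simp
  have := intervalIntegral.sum_integral_adjacent_intervals (μ := volume) (n := n)
    (f := fun y : ℝ => a ⌊y⌋₊) (a := fun k => (k : ℝ)) (fun k _ => (hi k).1)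
  simp only [(hi _).2, Nat.cast_zero] at this
  exact this

/-- The hypotheses force `s N = N^(1/q)`. Stating them through the `q`-th power covers both `√N` and
`√√N` directly. -/
lemma tendsto_scale_atTop {q : ℕ} (hq : q ≠ 0) {s : ℕ → ℝ} (hs0 : ∀ N, 0 ≤ s N)
    (hs : ∀ N, s N ^ q = N) : Tendsto s atTop atTop := by
  have h : s = fun N : ℕ => (N : ℝ) ^ ((q : ℝ)⁻¹) := by
    funext N; rw [← hs, Real.pow_rpow_inv_natCast (hs0 N) hq]
  rw [h]
  exact (tendsto_rpow_atTop (by positivity)).comp tendsto_natCast_atTop_atTop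

lemma one_le_scale {q : ℕ} {s : ℕ → ℝ} (hs0 : ∀ N, 0 ≤ s N)
    (hs : ∀ N, s N ^ q = N) {N : ℕ} (hN : 0 < N) : 1 ≤ s N := by
  by_contra! h
  have h1 : s N ^ q ≤ 1 := pow_le_one₀ (hs0 N) h.le
  rcases Nat.eq_zero_or_pos q with rfl | hq
  -- For `q = 0` the hypothesis at `N = 0` would read `1 = 0`.
  · have := hs 0; simp at this
  · have h2 : s N ^ q < 1 := pow_lt_one₀ (hs0 N) h hq.ne'
    rw [hs] at h2
    have : (1 : ℝ) ≤ N := by exact_mod_cast hN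
    linarith

lemma sq_scale_le {q : ℕ} (hq : 2 ≤ q) {s : ℕ → ℝ} (hs0 : ∀ N, 0 ≤ s N)
    (hs : ∀ N, s N ^ q = N) {N : ℕ} (hN : 0 < N) : s N ^ 2 ≤ N := by
  rw [← hs N]; exact pow_le_pow_right₀ (one_le_scale hs0 hs hN) hq

/-- The real number `k` at which `(2 k - N) / N = c + z / s N`. -/
def siteCoord (c : ℝ) (s : ℕ → ℝ) (N : ℕ) (z : ℝ) : ℝ := N * (1 + c) / 2 + N / (2 * s N) * z

/-- Rounding moves the site by at most `1`, hence the magnetization by at most `2 / N`. -/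
lemma abs_scaled_sub_le {c : ℝ} {s : ℕ → ℝ} {N : ℕ} (hN : 0 < N) (hsN : 0 < s N) {z : ℝ}
    (hy : 0 ≤ siteCoord c s N z) :
    |s N * (magnetization N ⌊siteCoord c s N z⌋₊ - c) - z| ≤ 2 * (s N / N) := by
  set y := siteCoord c s N z with hy_def
  have h1 := Nat.floor_le hy
  have h2 := Nat.lt_floor_add_one y
  have hNR : (0 : ℝ) < N := by positivity
  have h3 : s N * (magnetization N ⌊y⌋₊ - c) - z = 2 * (s N / N) * (⌊y⌋₊ - y) := by
    rw [hy_def, siteCoord, magnetization]; field_simp; ring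
  rw [h3, abs_mul, abs_of_nonneg (by positivity)]
  refine mul_le_of_le_one_right (by positivity) ?_
  rw [abs_le]; constructor <;> linarith

lemma sqrt_mul_spinWeight (p : ℕ) (β : ℝ) {N k : ℕ} (hk : 0 < k) (hkN : k < N) :
    √N * spinWeight p β N k = stirlingRatio N k * √(2 / (1 - magnetization N k ^ 2)) *
      Real.exp (N * curieWeissG p β (magnetization N k)) := by
  have hNR : (0 : ℝ) < N := by exact_mod_cast hk.trans hkN
  rw [spinWeight_eq p β hk hkN, div_mul_eq_div_div_swap, Real.sqrt_div' _ hNR.le]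
  have := Real.sqrt_pos.2 hNR
  field_simp

lemma magnetization_interior {N k : ℕ} (hN : 0 < N) (hk : k ≤ N)
    (h : 0 < 1 - magnetization N k ^ 2) : 0 < k ∧ k < N := by
  have e1 := one_add_magnetization (k := k) hN
  have e2 := one_sub_magnetization hN hk
  constructor
  · rcases Nat.eq_zero_or_pos k with rfl | h0
    · simp only [Nat.cast_zero, zero_mul] at e1
      nlinarith
    · exact h0
  · rcases hk.lt_or_eq with h0 | rfl
    · exact h0
    · simp only [Nat.sub_self, Nat.cast_zero, zero_mul] at e2
      nlinarith

lemma integral_comp_affine (H : ℝ → ℝ) (A B : ℝ) :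
    ∫ z, H (A + B * z) = |B⁻¹| * ∫ y, H y := by
  rw [Measure.integral_comp_mul_left (fun x => H (A + x)) B, smul_eq_mul,
    integral_add_left_eq_self]

/-- The rescaled step function whose integral is a local sum of spin weights. -/
def localStep (p : ℕ) (β c ε : ℝ) (s : ℕ → ℝ) (G : ℕ → ℝ → ℝ) (N : ℕ) (z : ℝ) : ℝ :=
  √N / 2 * (Set.Ico (0 : ℝ) (N + 1 : ℕ)).indicator (fun y =>
    if |magnetization N ⌊y⌋₊ - c| ≤ ε then
      spinWeight p β N ⌊y⌋₊ * G N (magnetization N ⌊y⌋₊) else 0) (siteCoord c s N z)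

/-- The affine substitution has Jacobian `2 s N / N`, which turns the factor `√N / 2` of `localStep`
into `s N / √N`. -/
lemma sum_eq_integral_localStep (p : ℕ) (β c ε : ℝ) {s : ℕ → ℝ} (G : ℕ → ℝ → ℝ) {N : ℕ}
    (hN : 0 < N) (hsN : 0 < s N) :
    s N / √N * ∑ k ∈ Finset.range (N + 1) with |magnetization N k - c| ≤ ε,
      spinWeight p β N k * G N (magnetization N k) = ∫ z, localStep p β c ε s G N z := by
  have hNR : (0 : ℝ) < N := by positivity
  unfold localStep siteCoord
  rw [integral_const_mul, integral_comp_affine _ (N * (1 + c) / 2) (N / (2 * s N)),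
    ← sum_range_eq_integral_floor (fun k => if |magnetization N k - c| ≤ ε then
      spinWeight p β N k * G N (magnetization N k) else 0), ← Finset.sum_filter, ← mul_assoc,
    abs_of_pos (by positivity)]
  congr 1
  have h2 : √(N : ℝ) ^ 2 = N := Real.sq_sqrt hNR.le
  have := Real.sqrt_pos.2 hNR
  field_simp
  exact h2.symm

lemma measurable_localStep (p : ℕ) (β c ε : ℝ) (s : ℕ → ℝ) (G : ℕ → ℝ → ℝ) (N : ℕ) :
    Measurable (localStep p β c ε s G N) := by
  have h : Measurable (siteCoord c s N) := by unfold siteCoord; fun_prop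
  refine Measurable.const_mul (Measurable.comp (g := Set.indicator _ _) ?_ h) _
  refine Measurable.indicator ?_ measurableSet_Ico
  exact (measurable_from_nat (f := fun k => if |magnetization N k - c| ≤ ε then
    spinWeight p β N k * G N (magnetization N k) else 0)).comp Nat.measurable_floor

/-! ### Laplace's method: domination, pointwise limit, tails -/

/-- An integrable majorant independent of `N`. With `w = s N (t - c)` one has `N g(t) ≤ -κ w^q`;
since `w^q ≥ w^2 - 1` and `|w - z| ≤ 2`, a Gaussian majorant works for every even `q ≥ 2`. -/
lemma abs_localStep_le {p : ℕ} {β c ε κ δ M : ℝ} {q : ℕ} (hq : Even q) (hq2 : 2 ≤ q)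
    (hκ : 0 < κ) (hδ : 0 < δ)
    (hε : ∀ t, |t - c| ≤ ε → δ ≤ 1 - t ^ 2 ∧ curieWeissG p β t ≤ -κ * (t - c) ^ q)
    {s : ℕ → ℝ} (hs0 : ∀ N, 0 ≤ s N) (hs : ∀ N, s N ^ q = N)
    {G : ℕ → ℝ → ℝ} (hM : ∀ N t, |G N t| ≤ M) {N : ℕ} (hN : 0 < N) (z : ℝ) :
    |localStep p β c ε s G N z| ≤
      Stirling.stirlingSeq 1 / Real.pi * √(2 / δ) * M * Real.exp (5 * κ) *
        Real.exp (-(κ / 2) * z ^ 2) := by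
  have hM0 : 0 ≤ M := (abs_nonneg _).trans (hM 0 0)
  have hS : 0 < Stirling.stirlingSeq 1 / Real.pi := div_pos (stirlingSeq_pos one_pos) Real.pi_pos
  have hB : 0 ≤ Stirling.stirlingSeq 1 / Real.pi * √(2 / δ) * M * Real.exp (5 * κ) *
      Real.exp (-(κ / 2) * z ^ 2) := by positivity
  have hNR : (0 : ℝ) < N := by positivity
  unfold localStep
  by_cases hy : siteCoord c s N z ∈ Set.Ico (0 : ℝ) (N + 1 : ℕ)
  swap
  · rw [Set.indicator_of_notMem hy]; simpa using hB
  rw [Set.indicator_of_mem hy]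
  have hs1 := one_le_scale hs0 hs hN
  have hdev := abs_scaled_sub_le hN (by linarith) hy.1
  set k := ⌊siteCoord c s N z⌋₊ with hk
  split_ifs with ht
  swap
  · simpa using hB
  have hkN : k ≤ N := by
    have : k < N + 1 := (Nat.floor_lt hy.1).2 hy.2
    omega
  obtain ⟨hd, hg⟩ := hε _ ht
  obtain ⟨hk0, hkN'⟩ := magnetization_interior hN hkN (hδ.trans_le hd)
  set t := magnetization N k
  have hdev2 : |s N * (t - c) - z| ≤ 2 := by
    refine hdev.trans ?_
    have h1 := sq_scale_le hq2 hs0 hs hN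
    have : s N / N ≤ 1 := (div_le_one hNR).2 (by nlinarith)
    linarith
  -- `w^q ≥ w^2 - 1` and `w^2 ≥ z^2 / 2 - 4` together give `-κ (z^2 / 2 - 5)`, whence the constant
  -- `5 κ`.
  have hexp : N * curieWeissG p β t ≤ 5 * κ + -(κ / 2) * z ^ 2 := by
    have h1 : N * curieWeissG p β t ≤ -κ * (s N * (t - c)) ^ q := by
      calc N * curieWeissG p β t ≤ N * (-κ * (t - c) ^ q) := mul_le_mul_of_nonneg_left hg hNR.le
        _ = -κ * (s N * (t - c)) ^ q := by rw [mul_pow, hs]; ring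
    set w := s N * (t - c)
    have h2 : w ^ 2 - 1 ≤ w ^ q := by
      rcases le_total 1 (w ^ 2) with h | h
      · obtain ⟨r, rfl⟩ := hq
        have : w ^ (r + r) = (w ^ 2) ^ r := by rw [← pow_mul]; congr 1; omega
        rw [this]
        have := le_self_pow₀ h (show r ≠ 0 by omega)
        linarith
      · have := hq.pow_nonneg w
        linarith
    have h3 : z ^ 2 / 2 - 4 ≤ w ^ 2 := by
      have := sq_le_sq' (by linarith [abs_le.1 hdev2]) (abs_le.1 hdev2).2
      nlinarith [sq_nonneg (2 * w - z)]
    nlinarith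
  calc |√N / 2 * (spinWeight p β N k * G N t)|
      = (√N * spinWeight p β N k) * |G N t| / 2 := by
        rw [abs_mul, abs_mul, abs_of_nonneg (spinWeight_nonneg p β N k),
          abs_of_nonneg (show 0 ≤ √(N : ℝ) / 2 by positivity)]
        ring
    _ ≤ (√N * spinWeight p β N k) * |G N t| := by
        have : 0 ≤ (√N * spinWeight p β N k) * |G N t| :=
          mul_nonneg (mul_nonneg (Real.sqrt_nonneg _) (spinWeight_nonneg _ _ _ _)) (abs_nonneg _)
        linarith
    _ ≤ (Stirling.stirlingSeq 1 / Real.pi * √(2 / δ) * Real.exp (5 * κ + -(κ / 2) * z ^ 2)) *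
          M := by
        rw [sqrt_mul_spinWeight p β hk0 hkN']
        have h1 := stirlingRatio_le hk0 hkN'
        have h2 := stirlingRatio_nonneg N k
        have h3 : √(2 / (1 - t ^ 2)) ≤ √(2 / δ) := Real.sqrt_le_sqrt (by gcongr)
        gcongr
        exact hM N t
    _ = _ := by rw [Real.exp_add]; ring

/-- The lattice point selected by `z` has rescaled deviation `w N → z`, not equal to `z`; this is
why `G` is assumed to converge jointly in `N` and the deviation. The exponent converges because `N
(t - c)^q = w^q`. -/
lemma tendsto_localStep {p : ℕ} {β c ε κ : ℝ} {q : ℕ} (hq2 : 2 ≤ q)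
    (hc : 0 < 1 - c ^ 2) (hε : 0 < ε)
    (hg : (fun t => curieWeissG p β t + κ * (t - c) ^ q) =o[𝓝 c] fun t => (t - c) ^ q)
    {s : ℕ → ℝ} (hs0 : ∀ N, 0 ≤ s N) (hs : ∀ N, s N ^ q = N)
    {G : ℕ → ℝ → ℝ} {z l : ℝ}
    (hG : Tendsto (fun a : ℕ × ℝ => G a.1 (c + a.2 / s a.1)) (atTop ×ˢ 𝓝 z) (𝓝 l)) :
    Tendsto (fun N => localStep p β c ε s G N z) atTop
      (𝓝 (l * (Real.exp (-κ * z ^ q) / √(2 * Real.pi * (1 - c ^ 2))))) := by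
  have hc1 : -1 < c ∧ c < 1 := by constructor <;> nlinarith
  have hsT := tendsto_scale_atTop (by omega) hs0 hs
  have hNT : Tendsto (fun N : ℕ => (N : ℝ)) atTop atTop := tendsto_natCast_atTop_atTop
  have hsinv : Tendsto (fun N => (s N)⁻¹) atTop (𝓝 0) := tendsto_inv_atTop_zero.comp hsT
  have hsdiv : Tendsto (fun N => s N / N) atTop (𝓝 0) := by
    refine squeeze_zero' (Eventually.of_forall fun N => div_nonneg (hs0 N) N.cast_nonneg) ?_ hsinv
    filter_upwards [eventually_gt_atTop 0] with N hN
    have h1 := one_le_scale hs0 hs hN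
    have h2 := sq_scale_le hq2 hs0 hs hN
    have hNR : (0 : ℝ) < N := by positivity
    rw [div_le_iff₀ hNR, ← div_eq_inv_mul, le_div_iff₀ (by linarith)]
    nlinarith
  have hypos : ∀ᶠ N : ℕ in atTop, 0 ≤ siteCoord c s N z := by
    have h1 : Tendsto (fun N => (1 + c) / 2 + (s N)⁻¹ * (z / 2)) atTop
        (𝓝 ((1 + c) / 2 + 0 * (z / 2))) := tendsto_const_nhds.add (hsinv.mul_const _)
    filter_upwards [h1.eventually_const_lt (show 0 < (1 + c) / 2 + 0 * (z / 2) by linarith)]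
      with N hN
    have : siteCoord c s N z = N * ((1 + c) / 2 + (s N)⁻¹ * (z / 2)) := by
      rw [siteCoord, mul_add, ← mul_div_assoc, div_mul_eq_div_div]; ring
    rw [this]; positivity
  set k : ℕ → ℕ := fun N => ⌊siteCoord c s N z⌋₊ with hk
  set t : ℕ → ℝ := fun N => magnetization N (k N) with ht
  set w : ℕ → ℝ := fun N => s N * (t N - c) with hw
  have hwz : Tendsto w atTop (𝓝 z) := by
    rw [tendsto_iff_dist_tendsto_zero]
    have h2 : Tendsto (fun N => 2 * (s N / N)) atTop (𝓝 0) := by simpa using hsdiv.const_mul 2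
    refine squeeze_zero' (Eventually.of_forall fun N => dist_nonneg) ?_ h2
    filter_upwards [hypos, eventually_gt_atTop 0] with N hN hN0
    exact abs_scaled_sub_le hN0 (lt_of_lt_of_le one_pos (one_le_scale hs0 hs hN0)) hN
  have htw : ∀ᶠ N in atTop, c + w N / s N = t N := by
    filter_upwards [eventually_gt_atTop 0] with N hN
    have := one_le_scale hs0 hs hN
    rw [hw]; field_simp; ring
  have htc : Tendsto t atTop (𝓝 c) := by
    have h1 : Tendsto (fun N => c + w N / s N) atTop (𝓝 (c + z * 0)) := by
      simp only [div_eq_mul_inv]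
      exact tendsto_const_nhds.add (hwz.mul hsinv)
    rw [mul_zero, add_zero] at h1
    exact h1.congr' htw
  have hkT : Tendsto k atTop atTop := by
    rw [← tendsto_natCast_atTop_iff (R := ℝ)]
    have h1 : Tendsto (fun N : ℕ => (1 + t N) / 2 * N) atTop atTop :=
      Tendsto.pos_mul_atTop (show 0 < (1 + c) / 2 by linarith)
        ((tendsto_const_nhds.add htc).div_const 2) hNT
    refine h1.congr' ?_
    filter_upwards [eventually_gt_atTop 0] with N hN
    rw [ht, one_add_magnetization hN]; field_simp
  have hNkR : Tendsto (fun N : ℕ => (N : ℝ) - k N) atTop atTop := by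
    have h1 : Tendsto (fun N : ℕ => (1 - t N) / 2 * N) atTop atTop :=
      Tendsto.pos_mul_atTop (show 0 < (1 - c) / 2 by linarith)
        ((tendsto_const_nhds.sub htc).div_const 2) hNT
    refine h1.congr' ?_
    filter_upwards [eventually_gt_atTop 0] with N hN
    rw [ht]; unfold magnetization; field_simp; ring
  have hkN : ∀ᶠ N in atTop, k N < N := by
    filter_upwards [hNkR.eventually_gt_atTop 0] with N hN
    exact_mod_cast sub_pos.1 hN
  have hNkT : Tendsto (fun N => N - k N) atTop atTop := by
    rw [← tendsto_natCast_atTop_iff (R := ℝ)]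
    refine hNkR.congr' ?_
    filter_upwards [hkN] with N hN
    push_cast [hN.le]; rfl
  have hR := tendsto_stirlingRatio hkT hNkT
  have hsq : Tendsto (fun N => √(2 / (1 - t N ^ 2))) atTop (𝓝 √(2 / (1 - c ^ 2))) :=
    (tendsto_const_nhds.div (tendsto_const_nhds.sub (htc.pow 2)) hc.ne').sqrt
  have hexp : Tendsto (fun N : ℕ => Real.exp (N * curieWeissG p β (t N))) atTop
      (𝓝 (Real.exp (-κ * z ^ q))) := by
    refine (Real.continuous_exp.tendsto _).comp ?_
    have h1 := hg.tendsto_div_nhds_zero.comp htc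
    -- Dividing by `(t - c)^q` and multiplying back is harmless even when `t = c`: there the
    -- little-o bound forces the numerator to vanish.
    have h2 := htc.eventually hg.eventually_mul_div_cancel
    have h3 : Tendsto (fun N => (curieWeissG p β (t N) + κ * (t N - c) ^ q) / (t N - c) ^ q *
        w N ^ q - κ * w N ^ q) atTop (𝓝 (0 * z ^ q - κ * z ^ q)) :=
      (h1.mul (hwz.pow q)).sub ((hwz.pow q).const_mul κ)
    rw [zero_mul, zero_sub, ← neg_mul] at h3
    refine h3.congr' ?_
    filter_upwards [h2] with N hN
    rw [Pi.mul_apply, Pi.div_apply] at hN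
    rw [hw]
    dsimp only
    rw [mul_pow, hs]
    linear_combination (N : ℝ) * hN
  have hGt : Tendsto (fun N => G N (t N)) atTop (𝓝 l) := by
    refine (hG.comp (tendsto_id.prodMk hwz)).congr' ?_
    filter_upwards [htw] with N hN
    simp only [Function.comp_apply, id_eq, hN]
  have hlim := ((((hR.mul hsq).mul hexp).mul hGt).div_const 2)
  have hval : 1 / √Real.pi * √(2 / (1 - c ^ 2)) * Real.exp (-κ * z ^ q) * l / 2 =
      l * (Real.exp (-κ * z ^ q) / √(2 * Real.pi * (1 - c ^ 2))) := by
    have e : √(2 * Real.pi * (1 - c ^ 2)) = √2 * √Real.pi * √(1 - c ^ 2) := by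
      rw [Real.sqrt_mul (by positivity), Real.sqrt_mul (by positivity)]
    rw [e, Real.sqrt_div' _ hc.le]
    have h1 := Real.sqrt_pos.2 Real.pi_pos
    have h2 := Real.sqrt_pos.2 hc
    have h3 : √(2 : ℝ) ^ 2 = 2 := Real.sq_sqrt (by norm_num)
    have h4 : 0 < √(2 : ℝ) := by positivity
    field_simp
    rw [h3, mul_comm]
  rw [hval] at hlim
  refine hlim.congr' ?_
  have hball : ∀ᶠ N in atTop, |t N - c| ≤ ε := by
    filter_upwards [htc.eventually (Metric.ball_mem_nhds c hε)] with N hN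
    exact (Metric.mem_ball.1 hN).le
  filter_upwards [hypos, hball, hkN, hkT.eventually_gt_atTop 0] with N hy hb hkN hk0
  have hmem : siteCoord c s N z ∈ Set.Ico (0 : ℝ) (N + 1 : ℕ) := by
    refine ⟨hy, ?_⟩
    have := Nat.lt_floor_add_one (siteCoord c s N z)
    have h2 : (k N : ℝ) < N := by exact_mod_cast hkN
    push_cast
    have : siteCoord c s N z < k N + 1 := this
    linarith
  unfold localStep
  rw [Set.indicator_of_mem hmem, if_pos hb]
  have := sqrt_mul_spinWeight p β hk0 hkN
  calc _ = (stirlingRatio N (k N) * √(2 / (1 - magnetization N (k N) ^ 2)) *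
      Real.exp (N * curieWeissG p β (magnetization N (k N)))) * G N (t N) / 2 := rfl
    _ = _ := by rw [← this]; ring

lemma eventually_forall_abs_sub_le {P : ℝ → Prop} {c : ℝ} (h : ∀ᶠ t in 𝓝 c, P t) :
    ∀ᶠ ε in 𝓝[>] (0 : ℝ), ∀ t, |t - c| ≤ ε → P t := by
  obtain ⟨r, hr, hP⟩ := Metric.eventually_nhds_iff.1 h
  filter_upwards [Ioo_mem_nhdsGT hr] with ε hε t ht
  exact hP (lt_of_le_of_lt ht hε.2)

/-- Laplace's method for the spin weights near a nondegenerate zero of `curieWeissG`. -/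
theorem tendsto_local_sum {p : ℕ} {β c κ : ℝ} {q : ℕ} (hq : Even q) (hq2 : 2 ≤ q)
    (hc : 0 < 1 - c ^ 2) (hκ : 0 < κ)
    (hg : (fun t => curieWeissG p β t + κ * (t - c) ^ q) =o[𝓝 c] fun t => (t - c) ^ q)
    {s : ℕ → ℝ} (hs0 : ∀ N, 0 ≤ s N) (hs : ∀ N, s N ^ q = N) :
    ∀ᶠ ε in 𝓝[>] (0 : ℝ), ∀ (G : ℕ → ℝ → ℝ) (M : ℝ) (f : ℝ → ℝ), (∀ N t, |G N t| ≤ M) →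
      (∀ᵐ z, Tendsto (fun a : ℕ × ℝ => G a.1 (c + a.2 / s a.1)) (atTop ×ˢ 𝓝 z) (𝓝 (f z))) →
      Tendsto (fun N : ℕ => s N / √N *
          ∑ k ∈ Finset.range (N + 1) with |magnetization N k - c| ≤ ε,
            spinWeight p β N k * G N (magnetization N k)) atTop
        (𝓝 (∫ z, f z * (Real.exp (-κ * z ^ q) / √(2 * Real.pi * (1 - c ^ 2))))) := by
  have h1 : ∀ᶠ t in 𝓝 c, (1 - c ^ 2) / 2 ≤ 1 - t ^ 2 := by
    have : Tendsto (fun t : ℝ => 1 - t ^ 2) (𝓝 c) (𝓝 (1 - c ^ 2)) :=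
      Continuous.tendsto (by fun_prop) c
    exact this.eventually_const_le (by linarith)
  have h2 : ∀ᶠ t in 𝓝 c, curieWeissG p β t ≤ -(κ / 2) * (t - c) ^ q := by
    filter_upwards [hg.bound (half_pos hκ)] with t ht
    rw [Real.norm_eq_abs, Real.norm_eq_abs, abs_of_nonneg (hq.pow_nonneg (t - c))] at ht
    have := (abs_le.1 ht).2
    linarith
  -- The admissible `ε` depend only on `g` near `c`, not on `G`, so one `ε` can later serve all
  -- centres.
  filter_upwards [eventually_forall_abs_sub_le (h1.and h2), self_mem_nhdsWithin]
    with ε hε hε0 G M f hM hG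
  have hdom : Tendsto (fun N => ∫ z, localStep p β c ε s G N z) atTop
      (𝓝 (∫ z, f z * (Real.exp (-κ * z ^ q) / √(2 * Real.pi * (1 - c ^ 2))))) := by
    refine tendsto_integral_filter_of_dominated_convergence
      (fun z => Stirling.stirlingSeq 1 / Real.pi * √(2 / ((1 - c ^ 2) / 2)) * M *
        Real.exp (5 * (κ / 2)) * Real.exp (-(κ / 2 / 2) * z ^ 2))
      (Eventually.of_forall fun N => (measurable_localStep p β c ε s G N).aestronglyMeasurable)
      ?_ ((integrable_exp_neg_mul_sq (by positivity)).const_mul _) ?_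
    · filter_upwards [eventually_gt_atTop 0] with N hN
      exact Eventually.of_forall fun z => abs_localStep_le hq hq2 (half_pos hκ)
        (half_pos hc) hε hs0 hs hM hN z
    · filter_upwards [hG] with z hz
      exact tendsto_localStep hq2 hc hε0 hg hs0 hs hz
  refine hdom.congr' ?_
  filter_upwards [eventually_gt_atTop 0] with N hN
  exact (sum_eq_integral_localStep p β c ε G hN
    (lt_of_lt_of_le one_pos (one_le_scale hs0 hs hN))).symm

lemma continuous_binaryEntropy : Continuous binaryEntropy := by
  unfold binaryEntropy
  have h1 : Continuous fun t : ℝ => (1 + t) * Real.log (1 + t) :=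
    Real.continuous_mul_log.comp (by fun_prop : Continuous fun t : ℝ => 1 + t)
  have h2 : Continuous fun t : ℝ => (1 - t) * Real.log (1 - t) :=
    Real.continuous_mul_log.comp (by fun_prop : Continuous fun t : ℝ => 1 - t)
  fun_prop

lemma continuous_curieWeissG (p : ℕ) (β : ℝ) : Continuous (curieWeissG p β) := by
  unfold curieWeissG
  have := continuous_binaryEntropy
  fun_prop

/-- By compactness `g ≤ -δ` outside the windows, so at most `N + 1` terms of size `M exp (-δ N)`
remain; the prefactor is at most `1` because `s N ^ 2 ≤ N`. -/
lemma tendsto_sum_spinWeight_away {p : ℕ} {β ε M : ℝ} {q : ℕ} (hq2 : 2 ≤ q) {C : Finset ℝ}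
    (hneg : ∀ t ∈ Set.Icc (-1 : ℝ) 1, t ∉ C → curieWeissG p β t < 0) (hε : 0 < ε)
    {s : ℕ → ℝ} (hs0 : ∀ N, 0 ≤ s N) (hs : ∀ N, s N ^ q = N)
    {G : ℕ → ℝ → ℝ} (hM : ∀ N t, |G N t| ≤ M) :
    Tendsto (fun N : ℕ => s N / √N *
        ∑ k ∈ Finset.range (N + 1) with ¬ ∃ c ∈ C, |magnetization N k - c| ≤ ε,
          spinWeight p β N k * G N (magnetization N k)) atTop (𝓝 0) := by
  have hM0 : 0 ≤ M := (abs_nonneg _).trans (hM 0 0)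
  set K : Set ℝ := Set.Icc (-1) 1 ∩ {t | ∀ c ∈ C, ε ≤ |t - c|} with hK
  have hKc : IsCompact K := by
    refine isCompact_Icc.inter_right ?_
    have : {t : ℝ | ∀ c ∈ C, ε ≤ |t - c|} = ⋂ c ∈ C, {t | ε ≤ |t - c|} := by ext; simp
    rw [this]
    exact isClosed_biInter fun c _ => isClosed_le continuous_const (by fun_prop)
  obtain ⟨δ, hδ, hKδ⟩ : ∃ δ > 0, ∀ t ∈ K, curieWeissG p β t ≤ -δ := by
    rcases K.eq_empty_or_nonempty with h | h
    · exact ⟨1, one_pos, by simp [h]⟩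
    · obtain ⟨t, ht, hmax⟩ := hKc.exists_isMaxOn h (continuous_curieWeissG p β).continuousOn
      refine ⟨-curieWeissG p β t, neg_pos.2 (hneg t ht.1 fun hC => ?_), fun u hu => ?_⟩
      · have := ht.2 t hC
        simp at this
        linarith
      · rw [neg_neg]; exact hmax hu
  have hlim : Tendsto (fun N : ℕ => M * (((N : ℝ) + 1) * Real.exp (-δ * N))) atTop (𝓝 0) := by
    have h1 := (Real.tendsto_pow_mul_exp_neg_atTop_nhds_zero 1).comp
      (tendsto_natCast_atTop_atTop.const_mul_atTop hδ)
    have h2 := (Real.tendsto_pow_mul_exp_neg_atTop_nhds_zero 0).comp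
      (tendsto_natCast_atTop_atTop.const_mul_atTop hδ)
    have h3 := ((h1.const_mul δ⁻¹).add h2).const_mul M
    simp only [mul_zero, add_zero] at h3
    refine h3.congr fun N => ?_
    simp only [Function.comp_apply, pow_one, pow_zero, one_mul, neg_mul]
    field_simp
  refine squeeze_zero_norm' ?_ hlim
  filter_upwards [eventually_gt_atTop 0] with N hN
  have hNR : (0 : ℝ) < N := by positivity
  have hpre : s N / √N ≤ 1 := by
    rw [div_le_one (Real.sqrt_pos.2 hNR)]
    exact Real.le_sqrt_of_sq_le (sq_scale_le hq2 hs0 hs hN)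
  rw [norm_mul, Real.norm_of_nonneg (div_nonneg (hs0 N) (Real.sqrt_nonneg _))]
  refine (mul_le_of_le_one_left (norm_nonneg _) hpre).trans ?_
  refine (norm_sum_le _ _).trans ?_
  have hterm : ∀ k ∈ (Finset.range (N + 1)).filter
      (fun k => ¬ ∃ c ∈ C, |magnetization N k - c| ≤ ε),
      ‖spinWeight p β N k * G N (magnetization N k)‖ ≤ Real.exp (-δ * N) * M := by
    intro k hk
    rw [Finset.mem_filter, Finset.mem_range] at hk
    have hkN : k ≤ N := by omega
    rw [norm_mul, Real.norm_of_nonneg (spinWeight_nonneg _ _ _ _)]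
    refine mul_le_mul ((spinWeight_le p β hN hkN).trans (Real.exp_le_exp.2 ?_)) (hM _ _)
      (norm_nonneg _) (Real.exp_pos _).le
    have := hKδ (magnetization N k) ⟨magnetization_mem_Icc hN hkN, fun c hc => by
      by_contra! h
      exact hk.2 ⟨c, hc, h.le⟩⟩
    nlinarith
  refine (Finset.sum_le_card_nsmul _ _ _ hterm).trans ?_
  rw [nsmul_eq_mul]
  have hcard : ((((Finset.range (N + 1)).filter
      (fun k => ¬ ∃ c ∈ C, |magnetization N k - c| ≤ ε)).card : ℕ) : ℝ) ≤ N + 1 := by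
    have := Finset.card_filter_le (Finset.range (N + 1))
      (fun k => ¬ ∃ c ∈ C, |magnetization N k - c| ≤ ε)
    rw [Finset.card_range] at this
    exact_mod_cast this
  calc _ ≤ ((N : ℝ) + 1) * (Real.exp (-δ * N) * M) := by gcongr
    _ = _ := by ring

/-- Laplace's method for sums of spin weights with finitely many nondegenerate maxima. -/
theorem tendsto_sum_spinWeight {p : ℕ} {β : ℝ} {q : ℕ} (hq : Even q) (hq2 : 2 ≤ q)
    {C : Finset ℝ} {κ : ℝ → ℝ} (hc : ∀ c ∈ C, 0 < 1 - c ^ 2) (hκ : ∀ c ∈ C, 0 < κ c)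
    (hg : ∀ c ∈ C, (fun t => curieWeissG p β t + κ c * (t - c) ^ q) =o[𝓝 c] fun t => (t - c) ^ q)
    (hneg : ∀ t ∈ Set.Icc (-1 : ℝ) 1, t ∉ C → curieWeissG p β t < 0)
    {s : ℕ → ℝ} (hs0 : ∀ N, 0 ≤ s N) (hs : ∀ N, s N ^ q = N)
    {G : ℕ → ℝ → ℝ} {M : ℝ} {f : ℝ → ℝ → ℝ} (hM : ∀ N t, |G N t| ≤ M)
    (hG : ∀ c ∈ C, ∀ᵐ z, Tendsto (fun a : ℕ × ℝ => G a.1 (c + a.2 / s a.1)) (atTop ×ˢ 𝓝 z)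
      (𝓝 (f c z))) :
    Tendsto (fun N : ℕ => s N / √N * ∑ k ∈ Finset.range (N + 1),
        spinWeight p β N k * G N (magnetization N k)) atTop
      (𝓝 (∑ c ∈ C, ∫ z, f c z * (Real.exp (-κ c * z ^ q) / √(2 * Real.pi * (1 - c ^ 2))))) := by
  have h1 := (eventually_all_finset C).2 fun c h =>
    tendsto_local_sum hq hq2 (hc c h) (hκ c h) (hg c h) hs0 hs
  -- This separation makes the windows around distinct centres disjoint.
  have h2 : ∀ᶠ ε in 𝓝[>] (0 : ℝ), ∀ c ∈ C, ∀ d ∈ C, c ≠ d → 2 * ε < |c - d| := by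
    refine (eventually_all_finset C).2 fun c _ => (eventually_all_finset C).2 fun d _ => ?_
    by_cases hcd : c = d
    · exact Eventually.of_forall fun ε h => absurd hcd h
    · have : 0 < |c - d| / 2 := half_pos (abs_pos.2 (sub_ne_zero.2 hcd))
      filter_upwards [Ioo_mem_nhdsGT this] with ε hε _
      linarith [hε.2]
  obtain ⟨ε, hε1, hε2, hε0⟩ := (h1.and (h2.and self_mem_nhdsWithin)).exists
  have hlim := (tendsto_finsetSum C fun c h => hε1 c h G M (f c) hM (hG c h)).add
    (tendsto_sum_spinWeight_away hq2 hneg hε0 hs0 hs hM)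
  rw [add_zero] at hlim
  refine hlim.congr fun N => ?_
  rw [← Finset.mul_sum, ← mul_add]
  congr 1
  rw [← Finset.sum_filter_add_sum_filter_not (Finset.range (N + 1))
    (fun k => ∃ c ∈ C, |magnetization N k - c| ≤ ε)]
  congr 1
  rw [← Finset.sum_biUnion]
  · refine Finset.sum_congr ?_ fun _ _ => rfl
    ext k
    simp only [Finset.mem_biUnion, Finset.mem_filter]
    tauto
  · intro c hcC d hdC hcd
    rw [Function.onFun, Finset.disjoint_left]
    intro k hk hk'
    rw [Finset.mem_filter] at hk hk'
    have h3 := hε2 c hcC d hdC hcd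
    have h4 := abs_sub_le c (magnetization N k) d
    rw [abs_sub_comm c (magnetization N k)] at h4
    linarith [hk.2, hk'.2]

/-! ### Derivatives and local expansions of `g` -/

lemma hasDerivAt_artanh {t : ℝ} (h : t ∈ Set.Ioo (-1 : ℝ) 1) :
    HasDerivAt Real.artanh (1 / (1 - t ^ 2)) t := by
  have h1 : 0 < 1 + t := by linarith [h.1]
  have h2 : 0 < 1 - t := by linarith [h.2]
  have hd : HasDerivAt (fun t : ℝ => 1 / 2 * (Real.log (1 + t) - Real.log (1 - t)))
      (1 / 2 * (1 / (1 + t) - -1 / (1 - t))) t :=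
    ((((hasDerivAt_id t).const_add 1).log h1.ne').sub
      (((hasDerivAt_id t).const_sub 1).log h2.ne')).const_mul _
  have he : Real.artanh =ᶠ[𝓝 t] fun t : ℝ => 1 / 2 * (Real.log (1 + t) - Real.log (1 - t)) := by
    filter_upwards [isOpen_Ioo.mem_nhds h] with u hu
    rw [Real.artanh_eq_half_log (Set.Ioo_subset_Icc_self hu), Real.log_div] <;> linarith [hu.1, hu.2]
  refine (hd.congr_of_eventuallyEq he).congr_deriv ?_
  have h3 : 1 - t ^ 2 = (1 + t) * (1 - t) := by ring
  rw [h3]; field_simp; ring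

lemma hasDerivAt_binaryEntropy {t : ℝ} (h : t ∈ Set.Ioo (-1 : ℝ) 1) :
    HasDerivAt binaryEntropy (Real.artanh t) t := by
  have h1 : 0 < 1 + t := by linarith [h.1]
  have h2 : 0 < 1 - t := by linarith [h.2]
  have d1 : HasDerivAt (fun t : ℝ => 1 + t) 1 t := (hasDerivAt_id t).const_add 1
  have d2 : HasDerivAt (fun t : ℝ => 1 - t) (-1) t := (hasDerivAt_id t).const_sub 1
  have hd := ((d1.mul (d1.log h1.ne')).add (d2.mul (d2.log h2.ne'))).const_mul (1 / 2)
  refine (hd.congr_deriv ?_ : HasDerivAt binaryEntropy _ t)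
  rw [Real.artanh_eq_half_log (Set.Ioo_subset_Icc_self h), Real.log_div h1.ne' h2.ne']
  field_simp
  ring

lemma hasDerivAt_curieWeissG (p : ℕ) (β : ℝ) {t : ℝ} (h : t ∈ Set.Ioo (-1 : ℝ) 1) :
    HasDerivAt (curieWeissG p β) (β * (p * t ^ (p - 1)) - Real.artanh t) t :=
  ((hasDerivAt_pow p t).const_mul β).sub (hasDerivAt_binaryEntropy h)

lemma hasDerivAt_deriv_curieWeissG (p : ℕ) (β : ℝ) {t : ℝ} (h : t ∈ Set.Ioo (-1 : ℝ) 1) :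
    HasDerivAt (fun t => β * (p * t ^ (p - 1)) - Real.artanh t)
      (β * (p * ((p - 1 : ℕ) * t ^ (p - 2))) - 1 / (1 - t ^ 2)) t :=
  (((hasDerivAt_pow (p - 1) t).const_mul (p : ℝ)).const_mul β).sub (hasDerivAt_artanh h)

lemma deriv_deriv_curieWeissG (p : ℕ) (β : ℝ) {t : ℝ} (h : t ∈ Set.Ioo (-1 : ℝ) 1) :
    deriv (deriv (curieWeissG p β)) t =
      β * (p * ((p - 1 : ℕ) * t ^ (p - 2))) - 1 / (1 - t ^ 2) := by
  have he : deriv (curieWeissG p β) =ᶠ[𝓝 t] fun t => β * (p * t ^ (p - 1)) - Real.artanh t := by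
    filter_upwards [isOpen_Ioo.mem_nhds h] with u hu
    exact (hasDerivAt_curieWeissG p β hu).deriv
  rw [he.deriv_eq]
  exact (hasDerivAt_deriv_curieWeissG p β h).deriv

/-- The mean value inequality on the closed ball of radius `|t - c|`, where `|f'| ≤ ε |t - c|^n`. It
integrates an expansion of `f'` to one of `f`. -/
lemma isLittleO_pow_succ_of_hasDerivAt {f f' : ℝ → ℝ} {c : ℝ} {n : ℕ}
    (hf : ∀ᶠ t in 𝓝 c, HasDerivAt f (f' t) t) (h0 : f c = 0)
    (h : f' =o[𝓝 c] fun t => (t - c) ^ n) : f =o[𝓝 c] fun t => (t - c) ^ (n + 1) := by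
  rw [Asymptotics.isLittleO_iff] at h ⊢
  intro ε hε
  obtain ⟨r, hr, hP⟩ := Metric.eventually_nhds_iff.1 (hf.and (h hε))
  filter_upwards [Metric.ball_mem_nhds c hr] with t ht
  have hd : ∀ x ∈ Metric.closedBall c |t - c|, dist x c < r := fun x hx =>
    lt_of_le_of_lt (Metric.mem_closedBall.1 hx) ht
  have := (convex_closedBall c |t - c|).norm_image_sub_le_of_norm_hasDerivWithin_le
    (f := f) (f' := f') (C := ε * |t - c| ^ n)
    (fun x hx => (hP (hd x hx)).1.hasDerivWithinAt)
    (fun x hx => by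
      refine (hP (hd x hx)).2.trans ?_
      rw [norm_pow, Real.norm_eq_abs]
      have : |x - c| ≤ |t - c| := Metric.mem_closedBall.1 hx
      gcongr)
    (Metric.mem_closedBall_self (abs_nonneg _)) (Metric.mem_closedBall.2 (le_refl |t - c|))
  rw [h0, sub_zero, Real.norm_eq_abs (t - c)] at this
  rw [norm_pow, Real.norm_eq_abs (t - c), pow_succ, ← mul_assoc]
  exact this

/-- Second-order expansion of `curieWeissG` at an interior critical zero. -/
lemma curieWeissG_isLittleO_sq {p : ℕ} {β c : ℝ} (hc : c ∈ Set.Ioo (-1 : ℝ) 1)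
    (h0 : curieWeissG p β c = 0) (h1 : β * (p * c ^ (p - 1)) = Real.artanh c) :
    (fun t => curieWeissG p β t + -(deriv (deriv (curieWeissG p β)) c) / 2 * (t - c) ^ 2)
      =o[𝓝 c] fun t => (t - c) ^ 2 := by
  set D := deriv (deriv (curieWeissG p β)) c with hD
  refine isLittleO_pow_succ_of_hasDerivAt (n := 1)
    (f' := fun t => (β * (p * t ^ (p - 1)) - Real.artanh t) + -D / 2 * (2 * (t - c))) ?_
    (by simp [h0]) ?_
  · filter_upwards [isOpen_Ioo.mem_nhds hc] with t ht
    have h2 : HasDerivAt (fun t : ℝ => (t - c) ^ 2) (2 * (t - c)) t := by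
      simpa using ((hasDerivAt_id t).sub_const c).fun_pow 2
    exact (hasDerivAt_curieWeissG p β ht).add (h2.const_mul _)
  · have h2 := (hasDerivAt_deriv_curieWeissG p β hc).isLittleO
    rw [← deriv_deriv_curieWeissG p β hc, ← hD] at h2
    simp only [h1, sub_self, sub_zero, smul_eq_mul] at h2
    refine (h2.congr (fun t => ?_) fun t => (pow_one _).symm)
    ring

/-- The derivative is `-t^4 / (1 - t^2)`, which is `o(t^2)`. The expansion is used twice for `p =
2`: integrated, for `g`, and directly, for the estimate. -/
lemma artanh_zero_quartic :
    (fun t : ℝ => t - Real.artanh t + t ^ 3 / 3) =o[𝓝 0] fun t => t ^ 3 := by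
  have key := isLittleO_pow_succ_of_hasDerivAt (c := 0) (n := 2)
    (f := fun t : ℝ => t - Real.artanh t + t ^ 3 / 3)
    (f' := fun t => 1 - 1 / (1 - t ^ 2) + t ^ 2) ?_ (by simp) ?_
  · simpa using key
  · filter_upwards [isOpen_Ioo.mem_nhds (show (0 : ℝ) ∈ Set.Ioo (-1 : ℝ) 1 by simp)] with t ht
    have h3 : HasDerivAt (fun t : ℝ => t ^ 3 / 3) (t ^ 2) t := by
      refine ((hasDerivAt_pow 3 t).div_const 3).congr_deriv ?_
      norm_num
    exact ((hasDerivAt_id t).sub (hasDerivAt_artanh ht)).add h3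
  · have h1 : Tendsto (fun t : ℝ => -t ^ 2 / (1 - t ^ 2)) (𝓝 0) (𝓝 0) := by
      have : ContinuousAt (fun t : ℝ => -t ^ 2 / (1 - t ^ 2)) 0 := by
        refine ContinuousAt.div (by fun_prop) (by fun_prop) (by simp)
      simpa [ContinuousAt] using this
    have h2 := ((Asymptotics.isLittleO_one_iff ℝ).2 h1).mul_isBigO
      (Asymptotics.isBigO_refl (fun t : ℝ => (t - 0) ^ 2) (𝓝 0))
    refine h2.congr' ?_ (by simp)
    filter_upwards [isOpen_Ioo.mem_nhds (show (0 : ℝ) ∈ Set.Ioo (-1 : ℝ) 1 by simp)] with t ht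
    have : 1 - t ^ 2 ≠ 0 := by nlinarith [ht.1, ht.2]
    field_simp
    ring

lemma curieWeissG_two_isLittleO_quartic :
    (fun t => curieWeissG 2 (1 / 2) t + 1 / 12 * (t - 0) ^ 4) =o[𝓝 0] fun t => (t - 0) ^ 4 := by
  refine isLittleO_pow_succ_of_hasDerivAt (n := 3)
    (f' := fun t => t - Real.artanh t + t ^ 3 / 3) ?_ (by simp [curieWeissG, binaryEntropy]) ?_
  · filter_upwards [isOpen_Ioo.mem_nhds (show (0 : ℝ) ∈ Set.Ioo (-1 : ℝ) 1 by simp)] with t ht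
    have h4 : HasDerivAt (fun t : ℝ => 1 / 12 * (t - 0) ^ 4) (t ^ 3 / 3) t := by
      simp only [sub_zero]
      refine ((hasDerivAt_pow 4 t).const_mul (1 / 12)).congr_deriv ?_
      norm_num
      ring
    refine ((hasDerivAt_curieWeissG 2 (1 / 2) ht).add h4).congr_deriv ?_
    norm_num
    ring
  · simpa using artanh_zero_quartic

/-! ### The threshold and its positive maximizer -/

lemma binaryEntropy_zero : binaryEntropy 0 = 0 := by simp [binaryEntropy]

lemma binaryEntropy_neg (t : ℝ) : binaryEntropy (-t) = binaryEntropy t := by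
  unfold binaryEntropy
  rw [sub_neg_eq_add, ← sub_eq_add_neg, add_comm ((1 - t) * _)]

lemma lt_artanh {t : ℝ} (h : t ∈ Set.Ioo (0 : ℝ) 1) : t < Real.artanh t := by
  have hd : ∀ x ∈ Set.Icc 0 t, HasDerivAt (fun x => Real.artanh x - x) (1 / (1 - x ^ 2) - 1) x :=
    fun x hx => (hasDerivAt_artanh ⟨by linarith [hx.1], by linarith [hx.2, h.2]⟩).sub
      (hasDerivAt_id x)
  have hm : StrictMonoOn (fun x => Real.artanh x - x) (Set.Icc 0 t) := by
    refine strictMonoOn_of_deriv_pos (convex_Icc 0 t)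
      (fun x hx => (hd x hx).continuousAt.continuousWithinAt) fun x hx => ?_
    rw [interior_Icc] at hx
    rw [(hd x (Set.Ioo_subset_Icc_self hx)).deriv, sub_pos, lt_div_iff₀]
    · nlinarith [hx.1]
    · nlinarith [hx.1, hx.2, h.2]
  have := hm (Set.left_mem_Icc.2 h.1.le) (Set.right_mem_Icc.2 h.1.le) h.1
  simp only [Real.artanh_zero, sub_zero] at this
  linarith

/-- For positive `t` the difference has derivative `artanh t - t > 0`; evenness gives the rest. It
makes `0` the only zero of `g` when `p = 2` and `β = 1/2`. -/
lemma sq_lt_binaryEntropy {t : ℝ} (h : t ∈ Set.Icc (-1 : ℝ) 1) (h0 : t ≠ 0) :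
    t ^ 2 / 2 < binaryEntropy t := by
  have key : ∀ t ∈ Set.Ioc (0 : ℝ) 1, t ^ 2 / 2 < binaryEntropy t := by
    intro t ht
    have hm : StrictMonoOn (fun x => binaryEntropy x - x ^ 2 / 2) (Set.Icc 0 1) := by
      refine strictMonoOn_of_deriv_pos (convex_Icc 0 1)
        (continuous_binaryEntropy.sub (by fun_prop)).continuousOn fun x hx => ?_
      rw [interior_Icc] at hx
      have hd : HasDerivAt (fun x : ℝ => binaryEntropy x - x ^ 2 / 2) (Real.artanh x - x) x := by
        refine ((hasDerivAt_binaryEntropy ⟨by linarith [hx.1], hx.2⟩).sub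
          ((hasDerivAt_pow 2 x).div_const 2)).congr_deriv ?_
        norm_num
      rw [hd.deriv, sub_pos]
      exact lt_artanh hx
    have := hm (Set.left_mem_Icc.2 zero_le_one) (Set.Ioc_subset_Icc_self ht) ht.1
    simp only [binaryEntropy_zero] at this
    norm_num at this
    linarith
  rcases lt_or_gt_of_ne h0 with h1 | h1
  · have := key (-t) ⟨by linarith, by linarith [h.1]⟩
    rw [binaryEntropy_neg] at this
    simpa using this
  · exact key t ⟨h1, h.2⟩

lemma binaryEntropy_nonneg {t : ℝ} (h : t ∈ Set.Icc (-1 : ℝ) 1) : 0 ≤ binaryEntropy t := by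
  rcases eq_or_ne t 0 with rfl | h0
  · rw [binaryEntropy_zero]
  · exact le_trans (by positivity) (sq_lt_binaryEntropy h h0).le

lemma sSup_curieWeissG_eq_zero_iff {p : ℕ} (hp : p ≠ 0) (β : ℝ) :
    sSup (curieWeissG p β '' Set.Icc 0 1) = 0 ↔ ∀ t ∈ Set.Icc (0 : ℝ) 1, curieWeissG p β t ≤ 0 := by
  have hb : BddAbove (curieWeissG p β '' Set.Icc 0 1) :=
    (isCompact_Icc.image (continuous_curieWeissG p β)).bddAbove
  have h0 : curieWeissG p β 0 = 0 := by simp [curieWeissG, binaryEntropy_zero, hp]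
  constructor
  · intro h t ht
    rw [← h]
    exact le_csSup hb ⟨t, ht, rfl⟩
  · intro h
    refine IsGreatest.csSup_eq ⟨⟨0, by simp, h0⟩, ?_⟩
    rintro _ ⟨t, ht, rfl⟩
    exact h t ht

/-- For `β > 1/2` the curvature `2 β - 1` at `0` is positive, so `g` takes positive values near `0`;
for `β ≤ 1/2` the bound `t^2 / 2 ≤ I(t)` suffices. -/
lemma curieWeissThreshold_two : curieWeissThreshold 2 = 1 / 2 := by
  have : {β : ℝ | 0 ≤ β ∧ sSup (curieWeissG 2 β '' Set.Icc 0 1) = 0} = Set.Icc 0 (1 / 2) := by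
    ext β
    simp only [Set.mem_ofPred_eq, Set.mem_Icc, sSup_curieWeissG_eq_zero_iff two_ne_zero]
    refine and_congr_right fun hβ => ⟨fun h => ?_, fun h t ht => ?_⟩
    · by_contra! hβ'
      have hD := deriv_deriv_curieWeissG 2 β (show (0 : ℝ) ∈ Set.Ioo (-1 : ℝ) 1 by simp)
      have ho := curieWeissG_isLittleO_sq (p := 2) (β := β)
        (show (0 : ℝ) ∈ Set.Ioo (-1 : ℝ) 1 by simp)
        (by simp [curieWeissG, binaryEntropy_zero]) (by simp)
      rw [hD] at ho
      norm_num at ho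
      have hb := ho.bound (show 0 < (2 * β - 1) / 4 by linarith)
      have hb' : ∀ᶠ t : ℝ in 𝓝[>] 0, _ := nhdsWithin_le_nhds hb
      obtain ⟨t, ht, ht1⟩ := (hb'.and (Ioo_mem_nhdsGT one_pos)).exists
      have h1 := h t ⟨ht1.1.le, ht1.2.le⟩
      have h2 : 0 < t ^ 2 := pow_pos ht1.1 2
      rw [Real.norm_eq_abs, Real.norm_of_nonneg h2.le] at ht
      have h3 := (abs_le.1 ht).1
      nlinarith [mul_pos h2 (show 0 < 2 * β - 1 by linarith)]
    · rcases eq_or_ne t 0 with rfl | h0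
      · simp [curieWeissG, binaryEntropy_zero]
      · have := sq_lt_binaryEntropy ⟨by linarith [ht.1], ht.2⟩ h0
        rw [curieWeissG]
        nlinarith [sq_nonneg t]
  rw [curieWeissThreshold, this, csSup_Icc (by norm_num)]

/-- Compactness gives a minimizer on `[1/2, 1]`. For `t ≤ 1/2` and `p ≥ 3`, `t^p ≤ t^3 ≤ t^2 / 2 <
I(t)`, so the ratio exceeds `1`, whereas at `t = 1` it is `log 2 ≤ 1`. -/
lemma exists_entropy_ratio_minimizer {p : ℕ} (hp : 3 ≤ p) :
    ∃ m ∈ Set.Ioc (0 : ℝ) 1, ∀ t ∈ Set.Ioc (0 : ℝ) 1,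
      binaryEntropy m / m ^ p ≤ binaryEntropy t / t ^ p := by
  have hcont : ContinuousOn (fun t : ℝ => binaryEntropy t / t ^ p) (Set.Icc (1 / 2) 1) :=
    continuous_binaryEntropy.continuousOn.div (by fun_prop) fun t ht =>
      (pow_pos (by linarith [ht.1]) p).ne'
  obtain ⟨m, hm, hmin⟩ := isCompact_Icc.exists_isMinOn (by norm_num) hcont
  refine ⟨m, ⟨by linarith [hm.1], hm.2⟩, fun t ht => ?_⟩
  rcases le_total (1 / 2) t with h | h
  · exact hmin ⟨h, ht.2⟩
  · refine (hmin (show (1 : ℝ) ∈ Set.Icc (1 / 2 : ℝ) 1 by norm_num)).trans ?_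
    have h1 : binaryEntropy 1 ≤ 1 := by
      unfold binaryEntropy
      norm_num
      linarith [Real.log_two_lt_d9]
    have h2 := sq_lt_binaryEntropy ⟨by linarith [ht.1], ht.2⟩ ht.1.ne'
    have h3 : t ^ p ≤ t ^ 3 := pow_le_pow_of_le_one ht.1.le ht.2 hp
    have h4 : t ^ p ≤ binaryEntropy t := by
      have : t ^ 3 ≤ t ^ 2 / 2 := by
        nlinarith [mul_nonneg (sq_nonneg t) (show 0 ≤ 1 / 2 - t by linarith)]
      linarith
    simp only [one_pow, div_one]
    exact h1.trans ((one_le_div (pow_pos ht.1 p)).2 h4)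

/-- For `t > 0`, `g(t) ≤ 0` means `β ≤ I(t) / t^p`. Hence the threshold is the minimum of this
ratio, and `g` vanishes at the minimizer. -/
lemma curieWeissThreshold_spec {p : ℕ} (hp : 3 ≤ p) :
    0 ≤ curieWeissThreshold p ∧
      (∀ t ∈ Set.Icc (0 : ℝ) 1, curieWeissG p (curieWeissThreshold p) t ≤ 0) ∧
      ∃ m ∈ Set.Ioc (0 : ℝ) 1, curieWeissG p (curieWeissThreshold p) m = 0 := by
  obtain ⟨m, hm, hmin⟩ := exists_entropy_ratio_minimizer hp
  have h0 : 0 ≤ binaryEntropy m / m ^ p :=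
    div_nonneg (binaryEntropy_nonneg ⟨by linarith [hm.1], hm.2⟩) (pow_nonneg hm.1.le _)
  have hle : ∀ β t : ℝ, t ∈ Set.Ioc (0 : ℝ) 1 →
      (curieWeissG p β t ≤ 0 ↔ β ≤ binaryEntropy t / t ^ p) := fun β t ht => by
    rw [curieWeissG, sub_nonpos, le_div_iff₀ (pow_pos ht.1 p)]
  have hz : ∀ β, curieWeissG p β 0 = 0 := fun β => by
    simp [curieWeissG, binaryEntropy_zero, show p ≠ 0 by omega]
  have hnonpos : ∀ β ≤ binaryEntropy m / m ^ p, ∀ t ∈ Set.Icc (0 : ℝ) 1,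
      curieWeissG p β t ≤ 0 := fun β hβ t ht => by
    rcases ht.1.eq_or_lt with rfl | h
    · exact (hz β).le
    · exact (hle β t ⟨h, ht.2⟩).2 (hβ.trans (hmin t ⟨h, ht.2⟩))
  have hβ : curieWeissThreshold p = binaryEntropy m / m ^ p := by
    have : {β : ℝ | 0 ≤ β ∧ sSup (curieWeissG p β '' Set.Icc 0 1) = 0} =
        Set.Icc 0 (binaryEntropy m / m ^ p) := by
      ext β
      simp only [Set.mem_ofPred_eq, Set.mem_Icc, sSup_curieWeissG_eq_zero_iff (show p ≠ 0 by omega)]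
      exact and_congr_right fun _ => ⟨fun h => (hle β m hm).1 (h m ⟨hm.1.le, hm.2⟩), hnonpos β⟩
    rw [curieWeissThreshold, this, csSup_Icc h0]
  rw [hβ]
  refine ⟨h0, hnonpos _ le_rfl, m, hm, ?_⟩
  rw [curieWeissG, div_mul_cancel₀ _ (pow_pos hm.1 p).ne', sub_self]

lemma curieWeissG_le_abs {p : ℕ} {β : ℝ} (hβ : 0 ≤ β) (t : ℝ) :
    curieWeissG p β t ≤ curieWeissG p β |t| := by
  unfold curieWeissG
  have h1 : binaryEntropy |t| = binaryEntropy t := by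
    rcases abs_choice t with h | h <;> rw [h]
    exact binaryEntropy_neg t
  have h2 : t ^ p ≤ |t| ^ p := by rw [← abs_pow]; exact le_abs_self _
  rw [h1]
  gcongr

lemma curieWeissG_threshold_nonpos {p : ℕ} (hp : 3 ≤ p) {t : ℝ} (ht : t ∈ Set.Icc (-1 : ℝ) 1) :
    curieWeissG p (curieWeissThreshold p) t ≤ 0 := by
  obtain ⟨h0, h1, -⟩ := curieWeissThreshold_spec hp
  exact (curieWeissG_le_abs h0 t).trans (h1 _ ⟨abs_nonneg t, abs_le.2 ht⟩)

lemma isPositiveMaximizer_iff {p : ℕ} (hp : 3 ≤ p) {m : ℝ} :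
    IsPositiveMaximizer p (curieWeissThreshold p) m ↔
      0 < m ∧ m ≤ 1 ∧ curieWeissG p (curieWeissThreshold p) m = 0 := by
  refine and_congr_right fun h0 => and_congr_right fun h1 => ⟨fun h => ?_, fun h t ht => ?_⟩
  · refine le_antisymm (curieWeissG_threshold_nonpos hp ⟨by linarith, h1⟩) ?_
    have := h 0 (by simp)
    simpa [curieWeissG, binaryEntropy_zero, show p ≠ 0 by omega] using this
  · rw [h]; exact curieWeissG_threshold_nonpos hp ht

lemma IsPositiveMaximizer.lt_one {p : ℕ} {β m : ℝ} (hβ : 0 ≤ β)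
    (h : IsPositiveMaximizer p β m) : m < 1 := by
  refine lt_of_le_of_ne h.2.1 fun h1 => ?_
  subst h1
  -- Chosen so that `artanh > p β + 1` on `(a, 1)`, where therefore `g' < 0`; a maximum at `1` would
  -- give a point of `(a, 1)` with `g' ≥ 0`.
  set a := Real.tanh (p * β + 1) with ha
  have ha1 : a < 1 := Real.tanh_lt_one _
  have haA : Real.artanh a = p * β + 1 := Real.artanh_tanh _
  have ha0 : 0 < a := by
    by_contra! hneg
    have := Real.artanh_nonpos hneg
    rw [haA] at this
    have : 0 ≤ p * β := by positivity
    linarith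
  obtain ⟨ξ, hξ, heq⟩ := exists_hasDerivAt_eq_slope (curieWeissG p β)
    (fun t => β * (p * t ^ (p - 1)) - Real.artanh t) ha1 (continuous_curieWeissG p β).continuousOn
    fun x hx => hasDerivAt_curieWeissG p β ⟨by linarith [hx.1], hx.2⟩
  have h1 : 0 ≤ (curieWeissG p β 1 - curieWeissG p β a) / (1 - a) :=
    div_nonneg (sub_nonneg.2 (h.2.2 a ⟨by linarith, ha1.le⟩)) (by linarith)
  rw [← heq] at h1
  have h2 := Real.artanh_lt_artanh (show -1 < a by linarith) hξ.2 hξ.1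
  have h3 : ξ ^ (p - 1) ≤ 1 := pow_le_one₀ (by linarith [hξ.1]) hξ.2.le
  have h4 : β * (p * ξ ^ (p - 1)) ≤ p * β := by
    calc β * (p * ξ ^ (p - 1)) = p * β * ξ ^ (p - 1) := by ring
      _ ≤ p * β * 1 := by gcongr
      _ = _ := mul_one _
  linarith

lemma IsPositiveMaximizer.critical {p : ℕ} {β m : ℝ} (h : IsPositiveMaximizer p β m)
    (h1 : m < 1) : β * (p * m ^ (p - 1)) = Real.artanh m := by
  have hm : m ∈ Set.Ioo (-1 : ℝ) 1 := ⟨by linarith [h.1], h1⟩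
  have hmax : IsLocalMax (curieWeissG p β) m := by
    filter_upwards [isOpen_Ioo.mem_nhds hm] with t ht
    exact h.2.2 t (Set.Ioo_subset_Icc_self ht)
  have := hmax.hasDerivAt_eq_zero (hasDerivAt_curieWeissG p β hm)
  linarith

/-- A function whose zeros on `(0, 1)` are the critical points of `I(t) / t^p`. -/
def entropyGap (p : ℕ) (t : ℝ) : ℝ := t * Real.artanh t - p * binaryEntropy t

/-- The derivative of `entropyGap`. -/
def entropyGapDeriv (p : ℕ) (t : ℝ) : ℝ :=
  Real.artanh t + t * (1 / (1 - t ^ 2)) - p * Real.artanh t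

lemma hasDerivAt_entropyGap (p : ℕ) {t : ℝ} (h : t ∈ Set.Ioo (-1 : ℝ) 1) :
    HasDerivAt (entropyGap p) (entropyGapDeriv p t) t := by
  refine (((hasDerivAt_id t).mul (hasDerivAt_artanh h)).sub
    ((hasDerivAt_binaryEntropy h).const_mul (p : ℝ))).congr_deriv ?_
  simp [entropyGapDeriv]

lemma hasDerivAt_entropyGapDeriv (p : ℕ) {t : ℝ} (h : t ∈ Set.Ioo (-1 : ℝ) 1) :
    HasDerivAt (entropyGapDeriv p) ((2 - p + p * t ^ 2) / (1 - t ^ 2) ^ 2) t := by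
  have h1 : 1 - t ^ 2 ≠ 0 := by nlinarith [h.1, h.2]
  have h2 : HasDerivAt (fun t : ℝ => 1 - t ^ 2) (-(2 * t)) t := by
    simpa using (hasDerivAt_pow 2 t).const_sub 1
  have h3 : HasDerivAt (fun t : ℝ => t * (1 / (1 - t ^ 2))) _ t :=
    (hasDerivAt_id t).mul ((hasDerivAt_const t (1 : ℝ)).div h2 h1)
  refine (((hasDerivAt_artanh h).add h3).sub ((hasDerivAt_artanh h).const_mul (p : ℝ))).congr_deriv ?_
  simp only [id_eq]
  field_simp
  ring

/-- The function also vanishes at `0`, so two positive zeros would give, by Rolle, two positive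
zeros of its derivative, whose numerator `2 - p + p t^2` has only one. -/
lemma entropyGapDeriv_no_two_zeros {p : ℕ} (hp : 3 ≤ p) {a b : ℝ} (h0 : 0 < a) (hab : a < b)
    (hb : b < 1) (ha : entropyGapDeriv p a = 0) : entropyGapDeriv p b ≠ 0 := by
  intro hb0
  have hz : entropyGapDeriv p 0 = 0 := by simp [entropyGapDeriv]
  have hd : ∀ t ∈ Set.Icc 0 b, HasDerivAt (entropyGapDeriv p)
      ((2 - p + p * t ^ 2) / (1 - t ^ 2) ^ 2) t := fun t ht =>
    hasDerivAt_entropyGapDeriv p ⟨by linarith [ht.1], by linarith [ht.2]⟩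
  have hc : ContinuousOn (entropyGapDeriv p) (Set.Icc 0 b) := fun t ht =>
    (hd t ht).continuousAt.continuousWithinAt
  obtain ⟨x, hx, hx0⟩ := exists_hasDerivAt_eq_zero h0
    (hc.mono (Set.Icc_subset_Icc_right hab.le)) (hz.trans ha.symm)
    fun t ht => hd t ⟨ht.1.le, by linarith [ht.2]⟩
  obtain ⟨y, hy, hy0⟩ := exists_hasDerivAt_eq_zero hab
    (hc.mono (Set.Icc_subset_Icc_left h0.le)) (ha.trans hb0.symm)
    fun t ht => hd t ⟨by linarith [ht.1], by linarith [ht.2]⟩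
  have key : ∀ t ∈ Set.Ioo 0 b, (2 - p + p * t ^ 2) / (1 - t ^ 2) ^ 2 = 0 →
      p * t ^ 2 = p - 2 := by
    intro t ht h
    have h1 : 1 - t ^ 2 ≠ 0 := by nlinarith [ht.1, ht.2]
    rcases div_eq_zero_iff.1 h with h | h
    · linarith
    · exact absurd h (pow_ne_zero 2 h1)
  have e1 := key x ⟨hx.1, by linarith [hx.2]⟩ hx0
  have e2 := key y ⟨by linarith [hy.1], hy.2⟩ hy0
  have hp' : (0 : ℝ) < p := by positivity
  have : x ^ 2 = y ^ 2 := mul_left_cancel₀ hp'.ne' (e1.trans e2.symm)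
  nlinarith [hx.1, hx.2, hy.1]

lemma entropyGap_exists_deriv_zero {p : ℕ} {a b : ℝ} (h0 : 0 ≤ a) (hab : a < b) (hb : b < 1)
    (ha0 : entropyGap p a = 0) (hb0 : entropyGap p b = 0) :
    ∃ x ∈ Set.Ioo a b, entropyGapDeriv p x = 0 := by
  have hd : ∀ t ∈ Set.Icc a b, HasDerivAt (entropyGap p) (entropyGapDeriv p t) t := fun t ht =>
    hasDerivAt_entropyGap p ⟨by linarith [ht.1], by linarith [ht.2]⟩
  exact exists_hasDerivAt_eq_zero hab (fun t ht => (hd t ht).continuousAt.continuousWithinAt)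
    (ha0.trans hb0.symm) fun t ht => hd t (Set.Ioo_subset_Icc_self ht)

lemma entropyGap_zero (p : ℕ) : entropyGap p 0 = 0 := by simp [entropyGap, binaryEntropy_zero]

/-- Eliminate `β` between `g(m) = 0` and `g'(m) = 0`. -/
lemma entropyGap_eq_zero {p : ℕ} (hp : 3 ≤ p) {m : ℝ}
    (h : IsPositiveMaximizer p (curieWeissThreshold p) m) : entropyGap p m = 0 := by
  have hc := h.critical (h.lt_one (curieWeissThreshold_spec hp).1)
  have hz := ((isPositiveMaximizer_iff hp).1 h).2.2
  rw [curieWeissG] at hz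
  have hpow : m ^ p = m * m ^ (p - 1) := by rw [← pow_succ']; congr 1; omega
  rw [entropyGap, ← hc]
  rw [hpow] at hz
  linear_combination (p : ℝ) * hz

/-- Two maximizers together with `0` would be three zeros of `entropyGap`, hence two zeros of its
derivative in `(0, 1)`. -/
theorem existsUnique_isPositiveMaximizer {p : ℕ} (hp : 3 ≤ p) :
    ∃! m : ℝ, IsPositiveMaximizer p (curieWeissThreshold p) m := by
  obtain ⟨hβ, -, m, hm, hm0⟩ := curieWeissThreshold_spec hp
  have key : ∀ a b : ℝ, IsPositiveMaximizer p (curieWeissThreshold p) a →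
      IsPositiveMaximizer p (curieWeissThreshold p) b → ¬ a < b := by
    intro a b ha hb hab
    have hb1 := hb.lt_one hβ
    obtain ⟨x, hx, hx0⟩ := entropyGap_exists_deriv_zero le_rfl ha.1 (hab.trans hb1)
      (entropyGap_zero p) (entropyGap_eq_zero hp ha)
    obtain ⟨y, hy, hy0⟩ := entropyGap_exists_deriv_zero ha.1.le hab hb1
      (entropyGap_eq_zero hp ha) (entropyGap_eq_zero hp hb)
    exact entropyGapDeriv_no_two_zeros hp hx.1 (hx.2.trans hy.1) (hy.2.trans hb1) hx0 hy0
  have hmax := (isPositiveMaximizer_iff hp).2 ⟨hm.1, hm.2, hm0⟩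
  exact ⟨m, hmax, fun y hy => le_antisymm (not_lt.1 (key m y hmax hy)) (not_lt.1 (key y m hy hmax))⟩

/-- Positive curvature would contradict `g ≤ 0`. Zero curvature would make `entropyGapDeriv` vanish
at `m`, in addition to its Rolle zero in `(0, m)`. -/
theorem thresholdCurvature_neg {p : ℕ} (hp : 3 ≤ p) {m : ℝ}
    (h : IsPositiveMaximizer p (curieWeissThreshold p) m) : thresholdCurvature p m < 0 := by
  have hβ := (curieWeissThreshold_spec hp).1
  have h1 := h.lt_one hβ
  have hm : m ∈ Set.Ioo (-1 : ℝ) 1 := ⟨by linarith [h.1], h1⟩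
  have hc := h.critical h1
  have hz := ((isPositiveMaximizer_iff hp).1 h).2.2
  have hgap : entropyGapDeriv p m = -(m * thresholdCurvature p m) := by
    have hpow : m ^ (p - 1) = m * m ^ (p - 2) := by rw [← pow_succ']; congr 1; omega
    have hp1 : ((p - 1 : ℕ) : ℝ) = p - 1 := by push_cast [show 1 ≤ p by omega]; rfl
    rw [hpow] at hc
    rw [thresholdCurvature, deriv_deriv_curieWeissG p _ hm, entropyGapDeriv, hp1]
    linear_combination ((p : ℝ) - 1) * hc
  refine lt_of_le_of_ne ?_ fun h0 => ?_
  · by_contra! hpos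
    have ho := curieWeissG_isLittleO_sq hm hz hc
    have hb := ho.bound (show 0 < thresholdCurvature p m / 4 by linarith)
    have hb' : ∀ᶠ t : ℝ in 𝓝[>] m, _ := nhdsWithin_le_nhds hb
    obtain ⟨t, ht, ht1⟩ := (hb'.and (Ioo_mem_nhdsGT h1)).exists
    have h2 := curieWeissG_threshold_nonpos hp ⟨by linarith [ht1.1, h.1], ht1.2.le⟩
    have h3 : 0 < (t - m) ^ 2 := pow_pos (by linarith [ht1.1]) 2
    rw [Real.norm_eq_abs, Real.norm_of_nonneg h3.le] at ht
    have h4 := (abs_le.1 ht).1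
    change -(thresholdCurvature p m / 4 * (t - m) ^ 2) ≤
      curieWeissG p (curieWeissThreshold p) t + -(thresholdCurvature p m) / 2 * (t - m) ^ 2 at h4
    nlinarith [mul_pos hpos h3]
  · rw [h0, mul_zero, neg_zero] at hgap
    obtain ⟨x, hx, hx0⟩ := entropyGap_exists_deriv_zero le_rfl h.1 h1
      (entropyGap_zero p) (entropyGap_eq_zero hp h)
    exact entropyGapDeriv_no_two_zeros hp hx.1 hx.2 h1 hx0 hgap

/-! ### Reduction to the mean spin -/

/-- The mean `N⁻¹ ∑ x_i` of a configuration. -/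
def meanSpin {N : ℕ} (x : SpinConfig N) : ℝ := (∑ i, spin x i) / N

lemma hamiltonian_curieWeissTensor {p N : ℕ} (hp : 1 ≤ p) (x : SpinConfig N) :
    hamiltonian (curieWeissTensor p N) x = N * meanSpin x ^ p := by
  unfold hamiltonian curieWeissTensor meanSpin
  rw [← Finset.mul_sum, ← Fintype.sum_pow]
  rcases Nat.eq_zero_or_pos N with rfl | hN
  · simp [show p ≠ 0 by omega]
  · obtain ⟨r, rfl⟩ : ∃ r, p = r + 1 := ⟨p - 1, by omega⟩
    rw [Nat.add_sub_cancel, div_pow]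
    field_simp
    ring

lemma localField_curieWeissTensor {p N : ℕ} (hp : 1 ≤ p) (x : SpinConfig N) (i : Fin N) :
    localField (curieWeissTensor p N) x i = meanSpin x ^ (p - 1) := by
  obtain ⟨r, rfl⟩ : ∃ r, p = r + 1 := ⟨p - 1, by omega⟩
  unfold localField curieWeissTensor meanSpin
  rw [← Finset.mul_sum, Nat.add_sub_cancel, div_pow, Fintype.sum_pow, one_div_mul_eq_div]
  congr 1
  refine Finset.sum_nbij' (fun j k => j k.succ) (fun j => Fin.cons i j) ?_ ?_ ?_ ?_ ?_
  · simp
  · intro j _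
    rw [Finset.mem_filter]
    refine ⟨Finset.mem_univ _, fun k hk => ?_⟩
    have : k = 0 := Fin.ext hk
    rw [this, Fin.cons_zero]
  · intro j hj
    rw [Finset.mem_filter] at hj
    funext k
    refine Fin.cases ?_ (fun k => ?_) k
    · rw [Fin.cons_zero, hj.2 0 rfl]
    · rw [Fin.cons_succ]
  · intro j _
    funext k
    rw [Fin.cons_succ]
  · intro j _
    rw [Finset.prod_filter, Fin.prod_univ_succ]
    simp

/-- The maximum pseudo-likelihood estimate as a function of the mean spin. -/
def meanEstimate (p : ℕ) (t : ℝ) : EReal :=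
  if t = 0 then 0
  else if |t| < 1 ∧ 0 ≤ Real.artanh t / (p * t ^ (p - 1)) then
    ((Real.artanh t / (p * t ^ (p - 1)) : ℝ) : EReal)
  else ⊤

/-- With equal local fields the equation is `t^p = t^(p-1) tanh (p b t^(p-1))`. At `t = 0` every `b`
solves it, so the infimum is `0`; otherwise cancel `t^(p-1)` and invert `tanh`, which leaves at most
one solution. -/
lemma mplEstimate_curieWeissTensor {p N : ℕ} (hp : 2 ≤ p) (hN : 0 < N) (x : SpinConfig N) :
    mplEstimate (curieWeissTensor p N) x = meanEstimate p (meanSpin x) := by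
  have hNR : (0 : ℝ) < N := by positivity
  have hpR : (0 : ℝ) < p := by positivity
  unfold mplEstimate meanEstimate
  simp only [hamiltonian_curieWeissTensor (show 1 ≤ p by omega),
    localField_curieWeissTensor (show 1 ≤ p by omega), Finset.sum_const, Finset.card_univ,
    Fintype.card_fin, nsmul_eq_mul]
  set t := meanSpin x
  split_ifs with h0 h1
  · refine le_antisymm (sInf_le ⟨0, ⟨le_rfl, ?_⟩, rfl⟩) (le_sInf ?_)
    · simp [h0, show p ≠ 0 by omega]
    · rintro _ ⟨b, hb, rfl⟩
      exact EReal.coe_nonneg.2 hb.1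
  all_goals
    have hpow : t ^ (p - 1) ≠ 0 := pow_ne_zero _ h0
    have hiff : ∀ b : ℝ, (N : ℝ) * t ^ p = N * (t ^ (p - 1) * Real.tanh (p * b * t ^ (p - 1))) ↔
        Real.tanh (p * b * t ^ (p - 1)) = t := by
      intro b
      have : t ^ p = t ^ (p - 1) * t := by rw [← pow_succ]; congr 1; omega
      rw [this, mul_right_inj' hNR.ne', mul_right_inj' hpow, eq_comm]
    simp only [hiff]
  · have hset : {b : ℝ | 0 ≤ b ∧ Real.tanh (p * b * t ^ (p - 1)) = t} =
        {Real.artanh t / (p * t ^ (p - 1))} := by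
      ext b
      rw [Set.mem_singleton_iff]
      constructor
      · rintro ⟨-, hb⟩
        have := Real.artanh_tanh (p * b * t ^ (p - 1))
        rw [hb] at this
        rw [this]; field_simp
      · rintro rfl
        refine ⟨h1.2, ?_⟩
        have : p * (Real.artanh t / (p * t ^ (p - 1))) * t ^ (p - 1) = Real.artanh t := by
          field_simp
        rw [this, Real.tanh_artanh (abs_lt.1 h1.1)]
    rw [hset, Set.image_singleton, sInf_singleton]
  · have hset : {b : ℝ | 0 ≤ b ∧ Real.tanh (p * b * t ^ (p - 1)) = t} = ∅ := by
      ext b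
      simp only [Set.mem_empty_iff_false, iff_false]
      rintro ⟨hb0, hb⟩
      refine h1 ⟨?_, ?_⟩
      · rw [← hb, abs_lt]; exact ⟨Real.neg_one_lt_tanh _, Real.tanh_lt_one _⟩
      · have := Real.artanh_tanh (p * b * t ^ (p - 1))
        rw [hb] at this
        rw [this]
        have : p * b * t ^ (p - 1) / (p * t ^ (p - 1)) = b := by field_simp
        rw [this]; exact hb0
    rw [hset, Set.image_empty, sInf_empty]

/-! ### Expectations under the model and the Gaussian mixture -/

instance measurableSingletonClass_spinConfig (N : ℕ) : MeasurableSingletonClass (SpinConfig N) := by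
  have : MeasurableSingletonClass ℤˣ := ⟨fun a => ⟨{(a : ℤ)}, MeasurableSet.singleton _, by
    ext b; simp [Units.ext_iff]⟩⟩
  infer_instance

lemma integral_isingMeasure {p N : ℕ} (J : InteractionTensor p N) (β : ℝ)
    (f : SpinConfig N → ℝ) :
    ∫ x, f x ∂isingMeasure J β = (∑ x, Real.exp (β * hamiltonian J x) * f x) /
      ∑ x, Real.exp (β * hamiltonian J x) := by
  unfold isingMeasure
  rw [integral_finsetSum_measure fun x _ => Integrable.of_finite.smul_measure ENNReal.ofReal_ne_top]
  simp only [integral_smul_measure, integral_dirac, smul_eq_mul,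
    ENNReal.toReal_ofReal (isingPMF_nonneg J β _)]
  rw [Finset.sum_div]
  refine Finset.sum_congr rfl fun x _ => ?_
  unfold isingPMF partitionFunction
  have h : 0 < ∑ x : SpinConfig N, Real.exp (β * hamiltonian J x) :=
    Finset.sum_pos (fun _ _ => Real.exp_pos _) Finset.univ_nonempty
  field_simp

lemma sum_spin_eq {N : ℕ} (x : SpinConfig N) :
    ∑ i, spin x i = 2 * ((Finset.univ.filter fun i => x i = 1).card : ℝ) - N := by
  have h : ∀ i, spin x i = 2 * (if x i = 1 then 1 else 0) - 1 := by
    intro i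
    unfold spin
    rcases Int.units_eq_one_or (x i) with h | h <;> rw [h] <;> norm_num
  simp only [h, Finset.sum_sub_distrib, ← Finset.mul_sum, Finset.sum_boole]
  simp

/-- Configurations correspond to their sets of positive spins, of which `N.choose k` have size `k`.
-/
lemma sum_spinConfig {N : ℕ} (f : ℝ → ℝ) :
    ∑ x : SpinConfig N, f (meanSpin x) =
      ∑ k ∈ Finset.range (N + 1), (N.choose k : ℝ) * f (magnetization N k) := by
  have h1 : ∑ x : SpinConfig N, f (meanSpin x) =
      ∑ s ∈ (Finset.univ : Finset (Fin N)).powerset, f (magnetization N s.card) := by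
    refine Finset.sum_nbij' (fun x => Finset.univ.filter fun i => x i = 1)
      (fun s i => if i ∈ s then 1 else -1) ?_ ?_ ?_ ?_ ?_
    · simp
    · simp
    · intro x _
      funext i
      rcases Int.units_eq_one_or (x i) with h | h <;> simp [h]
    · intro s _
      ext i
      by_cases h : i ∈ s <;> simp [h]
    · intro x _
      rw [meanSpin, sum_spin_eq, magnetization]
  rw [h1, Finset.sum_powerset_apply_card (fun k => f (magnetization N k))]
  simp

/-- The factor `* 1` presents the normalizing sum as the case `G = 1` of the numerator, so the same
Laplace asymptotics apply to both. -/
lemma integral_curieWeiss {p N : ℕ} (hp : 1 ≤ p) (β : ℝ) (G : ℝ → ℝ) :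
    ∫ x, G (meanSpin x) ∂isingMeasure (curieWeissTensor p N) β =
      (∑ k ∈ Finset.range (N + 1), spinWeight p β N k * G (magnetization N k)) /
        ∑ k ∈ Finset.range (N + 1), spinWeight p β N k * 1 := by
  rw [integral_isingMeasure]
  simp only [hamiltonian_curieWeissTensor hp]
  have key : ∀ H : ℝ → ℝ, ∑ x : SpinConfig N, Real.exp (β * (N * meanSpin x ^ p)) * H (meanSpin x) =
      2 ^ N * ∑ k ∈ Finset.range (N + 1), spinWeight p β N k * H (magnetization N k) := by
    intro H
    rw [sum_spinConfig fun t => Real.exp (β * (N * t ^ p)) * H t, Finset.mul_sum]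
    refine Finset.sum_congr rfl fun k _ => ?_
    unfold spinWeight
    field_simp
  have k1 := key fun _ => 1
  simp only [mul_one] at k1 ⊢
  rw [key, k1, mul_div_mul_left _ _ (by positivity)]

lemma tendsto_integral_curieWeiss {p : ℕ} (hp : 1 ≤ p) {β : ℝ} {q : ℕ} (hq : Even q) (hq2 : 2 ≤ q)
    {C : Finset ℝ} {κ : ℝ → ℝ} (hc : ∀ c ∈ C, 0 < 1 - c ^ 2) (hκ : ∀ c ∈ C, 0 < κ c)
    (hg : ∀ c ∈ C, (fun t => curieWeissG p β t + κ c * (t - c) ^ q) =o[𝓝 c] fun t => (t - c) ^ q)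
    (hneg : ∀ t ∈ Set.Icc (-1 : ℝ) 1, t ∉ C → curieWeissG p β t < 0)
    {s : ℕ → ℝ} (hs0 : ∀ N, 0 ≤ s N) (hs : ∀ N, s N ^ q = N)
    (hZ : ∑ c ∈ C, ∫ z : ℝ, 1 * (Real.exp (-κ c * z ^ q) / √(2 * Real.pi * (1 - c ^ 2))) ≠ 0)
    {G : ℕ → ℝ → ℝ} {M : ℝ} {f : ℝ → ℝ → ℝ} (hM : ∀ N t, |G N t| ≤ M)
    (hG : ∀ c ∈ C, ∀ᵐ z, Tendsto (fun a : ℕ × ℝ => G a.1 (c + a.2 / s a.1)) (atTop ×ˢ 𝓝 z)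
      (𝓝 (f c z))) :
    Tendsto (fun N : ℕ => ∫ x, G N (meanSpin x) ∂isingMeasure (curieWeissTensor p N) β) atTop
      (𝓝 ((∑ c ∈ C, ∫ z, f c z * (Real.exp (-κ c * z ^ q) / √(2 * Real.pi * (1 - c ^ 2)))) /
        ∑ c ∈ C, ∫ z : ℝ, 1 * (Real.exp (-κ c * z ^ q) / √(2 * Real.pi * (1 - c ^ 2))))) := by
  have h1 := tendsto_sum_spinWeight hq hq2 hc hκ hg hneg hs0 hs hM hG
  have h2 := tendsto_sum_spinWeight hq hq2 hc hκ hg hneg hs0 hs (G := fun _ _ => 1) (M := 1)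
    (f := fun _ _ => 1) (by simp) fun c _ => Eventually.of_forall fun z => tendsto_const_nhds
  refine (h1.div h2 hZ).congr' ?_
  filter_upwards [eventually_gt_atTop 0] with N hN
  have hsN := one_le_scale hs0 hs hN
  have : (0 : ℝ) < N := by positivity
  rw [Pi.div_apply, integral_curieWeiss hp, mul_div_mul_left]
  have := Real.sqrt_pos.2 this
  positivity

/-- A quadratic zero contributes mass `((1 - c^2) 2 κ)^(-1/2)` times a centred Gaussian of variance
`1 / (2 κ)`. This is `1` at `c = 0`, `κ = 1/2`, and `((m^2 - 1) g''(m))^(-1/2)` at `c = m`, `κ =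
-g''(m) / 2`. -/
lemma integral_gaussian_kernel {κ c : ℝ} (hκ : 0 < κ) (hc : 0 < 1 - c ^ 2) (f : ℝ → ℝ) :
    ∫ z, f z * (Real.exp (-κ * z ^ 2) / √(2 * Real.pi * (1 - c ^ 2))) =
      (√((1 - c ^ 2) * (2 * κ)))⁻¹ * ∫ z, f z ∂gaussianReal 0 (1 / (2 * κ)).toNNReal := by
  have hv : 0 < 1 / (2 * κ) := by positivity
  rw [integral_gaussianReal_eq_integral_smul (by simpa using hκ), ← integral_const_mul]
  refine integral_congr_ae (Eventually.of_forall fun z => ?_)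
  simp only [gaussianPDFReal, Real.coe_toNNReal _ hv.le, sub_zero, smul_eq_mul]
  have h1 : -z ^ 2 / (2 * (1 / (2 * κ))) = -κ * z ^ 2 := by field_simp
  have h2 : √(2 * Real.pi * (1 - c ^ 2)) =
      √((1 - c ^ 2) * (2 * κ)) * √(2 * Real.pi * (1 / (2 * κ))) := by
    rw [← Real.sqrt_mul (by positivity)]; congr 1; field_simp
  rw [h1, h2, div_eq_mul_inv, mul_inv]
  ring

lemma integral_gaussianReal_comp_neg (v : NNReal) (f : ℝ → ℝ) :
    ∫ z, f (-z) ∂gaussianReal 0 v = ∫ z, f z ∂gaussianReal 0 v := by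
  have h := gaussianReal_map_neg (μ := 0) (v := v)
  rw [neg_zero] at h
  conv_rhs => rw [← h]
  exact (integral_map_equiv (MeasurableEquiv.neg ℝ) f).symm

lemma curieWeissG_neg {p : ℕ} (hp : Even p) (β t : ℝ) :
    curieWeissG p β (-t) = curieWeissG p β t := by
  rw [curieWeissG, curieWeissG, hp.neg_pow, binaryEntropy_neg]

lemma curieWeissG_neg_of_odd {p : ℕ} (hp : Odd p) {β t : ℝ} (hβ : 0 ≤ β)
    (ht : t ∈ Set.Ico (-1 : ℝ) 0) : curieWeissG p β t < 0 := by
  have h1 := sq_lt_binaryEntropy ⟨ht.1, by linarith [ht.2]⟩ ht.2.ne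
  have h2 : β * t ^ p ≤ 0 := mul_nonpos_of_nonneg_of_nonpos hβ (hp.pow_nonpos ht.2.le)
  rw [curieWeissG]
  nlinarith [sq_nonneg t]

lemma inv_sqrt_eq_rpow {x : ℝ} (hx : 0 ≤ x) : (√x)⁻¹ = x ^ (-(1 / 2) : ℝ) := by
  rw [Real.sqrt_eq_rpow, Real.rpow_neg hx]

lemma thresholdCurvature_expansion_zero {p : ℕ} (hp : 3 ≤ p) :
    (fun t => curieWeissG p (curieWeissThreshold p) t + 1 / 2 * (t - 0) ^ 2)
      =o[𝓝 0] fun t => (t - 0) ^ 2 := by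
  have h := curieWeissG_isLittleO_sq (p := p) (β := curieWeissThreshold p) (c := 0) (by simp)
    (by simp [curieWeissG, binaryEntropy_zero, show p ≠ 0 by omega])
    (by simp [show p - 1 ≠ 0 by omega])
  rw [deriv_deriv_curieWeissG _ _ (by simp)] at h
  simpa [show p - 2 ≠ 0 by omega] using h

/-- Expectations at the threshold converge to the two-component Gaussian mixture. -/
theorem tendsto_integral_threshold {p : ℕ} (hp : 3 ≤ p) {m : ℝ}
    (hm : IsPositiveMaximizer p (curieWeissThreshold p) m)
    {G : ℕ → ℝ → ℝ} {M : ℝ} (hM : ∀ N t, |G N t| ≤ M)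
    (hsym : Even p → ∀ N t, G N (-t) = G N t) {f₀ f₁ : ℝ → ℝ}
    (h₀ : ∀ᵐ z, Tendsto (fun a : ℕ × ℝ => G a.1 (0 + a.2 / √(a.1 : ℝ))) (atTop ×ˢ 𝓝 z) (𝓝 (f₀ z)))
    (h₁ : ∀ᵐ z, Tendsto (fun a : ℕ × ℝ => G a.1 (m + a.2 / √(a.1 : ℝ))) (atTop ×ˢ 𝓝 z)
      (𝓝 (f₁ z))) :
    Tendsto (fun N : ℕ => ∫ x, G N (meanSpin x) ∂thresholdMeasure p N) atTop
      (𝓝 (mixtureWeight p m * ∫ z, f₀ z ∂gaussianReal 0 1 + (1 - mixtureWeight p m) *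
        ∫ z, f₁ z ∂gaussianReal 0 (1 / -thresholdCurvature p m).toNNReal)) := by
  obtain ⟨hβ, -, -⟩ := curieWeissThreshold_spec hp
  have hm1 := hm.lt_one hβ
  have hm0 := hm.1
  have hcurv := thresholdCurvature_neg hp hm
  have hz := ((isPositiveMaximizer_iff hp).1 hm).2.2
  have hexp_m := curieWeissG_isLittleO_sq ⟨by linarith, hm1⟩ hz (hm.critical hm1)
  change (fun t => curieWeissG p (curieWeissThreshold p) t +
    -(thresholdCurvature p m) / 2 * (t - m) ^ 2) =o[𝓝 m] fun t => (t - m) ^ 2 at hexp_m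
  set β := curieWeissThreshold p with hβdef
  set D := thresholdCurvature p m with hD
  have hzero : ∀ t ∈ Set.Ioc (0 : ℝ) 1, t ≠ m → curieWeissG p β t < 0 := fun t ht htm => by
    refine lt_of_le_of_ne (curieWeissG_threshold_nonpos hp ⟨by linarith [ht.1], ht.2⟩) fun h => ?_
    exact htm ((existsUnique_isPositiveMaximizer hp).unique
      ((isPositiveMaximizer_iff hp).2 ⟨ht.1, ht.2, h⟩) hm)
  have hmm : 0 < 1 - m ^ 2 := by nlinarith
  have hw : (√((1 - m ^ 2) * (2 * (-D / 2))))⁻¹ = ((m ^ 2 - 1) * D) ^ (-(1 / 2) : ℝ) := by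
    rw [inv_sqrt_eq_rpow (mul_nonneg hmm.le (by linarith))]; congr 1; ring
  have hw0 : (√((1 - (0 : ℝ) ^ 2) * (2 * (1 / 2))))⁻¹ = 1 := by norm_num
  have hv : (1 / (2 * (-D / 2)) : ℝ) = 1 / -D := by congr 1; ring
  have hv0 : (1 / (2 * (1 / 2)) : ℝ).toNNReal = 1 := by norm_num
  set A : ℝ := ((m ^ 2 - 1) * D) ^ (-(1 / 2) : ℝ) with hA
  have hA0 : 0 ≤ A := rpow_neg_half_nonneg _
  have hDh : 0 < -D / 2 := by linarith
  have hI0 := fun f => integral_gaussian_kernel (κ := 1 / 2) (c := 0) (by norm_num) (by norm_num) f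
  have hIm := fun f => integral_gaussian_kernel hDh hmm f
  have hInm := fun f => integral_gaussian_kernel (c := -m) hDh (by rwa [neg_sq]) f
  simp only [neg_sq m] at hInm
  rw [hw0, hv0] at hI0
  rw [hw, hv] at hIm hInm
  have hs : ∀ N : ℕ, √(N : ℝ) ^ 2 = N := fun N => Real.sq_sqrt N.cast_nonneg
  have hα : mixtureWeight p m = if Even p then 1 / (1 + 2 * A) else 1 / (1 + A) := rfl
  set κ : ℝ → ℝ := fun c => if c = 0 then 1 / 2 else -D / 2 with hκdef
  have hκ0 : κ 0 = 1 / 2 := if_pos rfl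
  have hκm : κ m = -D / 2 := if_neg hm0.ne'
  have hκnm : κ (-m) = -D / 2 := if_neg (neg_ne_zero.2 hm0.ne')
  -- For even `p` there is a third zero `-m`. Since `G` is even, a deviation `z` from `-m` acts as
  -- `-z` from `m`, and the symmetric Gaussian makes its contribution equal to that of `m`: masses
  -- `1 : A : A`.
  by_cases hpe : Even p
  · set f : ℝ → ℝ → ℝ := fun c => if c = 0 then f₀ else if c = m then f₁ else fun z => f₁ (-z)
      with hf
    have hf0 : f 0 = f₀ := if_pos rfl
    have hfm : f m = f₁ := by simp [hf, hm0.ne']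
    have hfnm : f (-m) = fun z => f₁ (-z) := by
      simp [hf, hm0.ne', show ¬ (-m = m) by linarith]
    have hn1 : (0 : ℝ) ∉ ({m, -m} : Finset ℝ) := by simp [hm0.ne, hm0.ne']
    have hn2 : m ∉ ({-m} : Finset ℝ) := by
      rw [Finset.mem_singleton]; linarith
    have hexp_nm : (fun t => curieWeissG p β t + -D / 2 * (t - -m) ^ 2) =o[𝓝 (-m)]
        fun t => (t - -m) ^ 2 := by
      have ht : Tendsto (fun t : ℝ => -t) (𝓝 (-m)) (𝓝 m) := by
        simpa using (continuous_neg.tendsto (-m))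
      refine (hexp_m.comp_tendsto ht).congr (fun t => ?_) fun t => ?_
      · simp only [Function.comp_apply, curieWeissG_neg hpe]; ring
      · simp only [Function.comp_apply]; ring
    have hG_nm : ∀ᵐ z, Tendsto (fun a : ℕ × ℝ => G a.1 (-m + a.2 / √(a.1 : ℝ))) (atTop ×ˢ 𝓝 z)
        (𝓝 (f₁ (-z))) := by
      have := (Measure.measurePreserving_neg (volume : Measure ℝ)).quasiMeasurePreserving.ae h₁
      filter_upwards [this] with z hz
      have ht : Tendsto (fun a : ℕ × ℝ => (a.1, -a.2)) (atTop ×ˢ 𝓝 z) (atTop ×ˢ 𝓝 (-z)) :=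
        tendsto_fst.prodMk ((continuous_neg.tendsto z).comp tendsto_snd)
      refine (hz.comp ht).congr fun a => ?_
      simp only [Function.comp_apply]
      rw [← hsym hpe]
      congr 1; ring
    have key := tendsto_integral_curieWeiss (p := p) (by omega) (β := β) even_two le_rfl
      (C := {0, m, -m}) (κ := κ) (s := fun N : ℕ => √(N : ℝ)) (G := G) (M := M) (f := f)
      (by simpa using hmm) (by simp [hκ0, hκm, hκnm]; linarith)
      (by
        simp only [Finset.forall_mem_insert, Finset.mem_singleton, forall_eq, hκ0, hκm, hκnm]
        exact ⟨thresholdCurvature_expansion_zero hp, hexp_m, hexp_nm⟩)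
      (by
        intro t ht htC
        simp only [Finset.mem_insert, Finset.mem_singleton, not_or] at htC
        rcases lt_or_gt_of_ne htC.1 with h | h
        · rw [← curieWeissG_neg hpe]
          exact hzero (-t) ⟨by linarith, by linarith [ht.1]⟩ fun h' => htC.2.2 (by linarith)
        · exact hzero t ⟨h, ht.2⟩ htC.2.1)
      (fun N => Real.sqrt_nonneg _) hs
      (by
        rw [Finset.sum_insert hn1, Finset.sum_insert hn2, Finset.sum_singleton, hκ0, hκm, hκnm]
        rw [hI0 fun _ => 1]
        simp only [neg_sq m]
        rw [hIm fun _ => 1]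
        simp
        positivity) hM
      (by
        simp only [Finset.forall_mem_insert, Finset.mem_singleton, forall_eq, hf0, hfm, hfnm]
        exact ⟨h₀, h₁, hG_nm⟩)
    rw [Finset.sum_insert hn1, Finset.sum_insert hn2, Finset.sum_singleton,
      Finset.sum_insert hn1, Finset.sum_insert hn2, Finset.sum_singleton, hκ0, hκm, hκnm,
      hf0, hfm, hfnm] at key
    simp only [neg_sq m] at key
    rw [hI0, hIm, hInm fun z => f₁ (-z), hI0 fun _ => 1, hIm fun _ => 1,
      integral_gaussianReal_comp_neg] at key
    convert! key using 2
    rw [hα, if_pos hpe]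
    simp only [integral_const, probReal_univ, smul_eq_mul, mul_one]
    field_simp
    ring
  -- For odd `p`, `g < 0` on `[-1, 0)`, so only `0` and `m` contribute, with masses `1 : A`.
  · set f : ℝ → ℝ → ℝ := fun c => if c = 0 then f₀ else f₁ with hf
    have hf0 : f 0 = f₀ := if_pos rfl
    have hfm : f m = f₁ := if_neg hm0.ne'
    have hn1 : (0 : ℝ) ∉ ({m} : Finset ℝ) := by simp [hm0.ne]
    have key := tendsto_integral_curieWeiss (p := p) (by omega) (β := β) even_two le_rfl
      (C := {0, m}) (κ := κ) (s := fun N : ℕ => √(N : ℝ)) (G := G) (M := M) (f := f)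
      (by simpa using hmm) (by simp [hκ0, hκm]; linarith)
      (by
        simp only [Finset.forall_mem_insert, Finset.mem_singleton, forall_eq, hκ0, hκm]
        exact ⟨thresholdCurvature_expansion_zero hp, hexp_m⟩)
      (by
        intro t ht htC
        simp only [Finset.mem_insert, Finset.mem_singleton, not_or] at htC
        rcases lt_or_gt_of_ne htC.1 with h | h
        · exact curieWeissG_neg_of_odd (Nat.not_even_iff_odd.1 hpe) hβ ⟨ht.1, h⟩
        · exact hzero t ⟨h, ht.2⟩ htC.2)
      (fun N => Real.sqrt_nonneg _) hs
      (by
        rw [Finset.sum_insert hn1, Finset.sum_singleton, hκ0, hκm]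
        rw [hI0 fun _ => 1, hIm fun _ => 1]
        simp
        positivity) hM
      (by
        simp only [Finset.forall_mem_insert, Finset.mem_singleton, forall_eq, hf0, hfm]
        exact ⟨h₀, h₁⟩)
    rw [Finset.sum_insert hn1, Finset.sum_singleton, Finset.sum_insert hn1,
      Finset.sum_singleton, hκ0, hκm, hf0, hfm, hI0, hIm, hI0 fun _ => 1, hIm fun _ => 1] at key
    convert! key using 2
    rw [hα, if_neg hpe]
    simp only [integral_const, probReal_univ, smul_eq_mul, mul_one]
    field_simp
    ring

/-! ### Asymptotics of the estimate near `0` and near `m` -/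

lemma artanh_neg_eq (t : ℝ) : Real.artanh (-t) = -Real.artanh t := by
  unfold Real.artanh
  rw [← Real.log_inv, ← Real.sqrt_inv, inv_div, sub_neg_eq_add, ← sub_eq_add_neg]

lemma meanEstimate_neg {p : ℕ} (hp : Even p) (hp1 : 1 ≤ p) (t : ℝ) :
    meanEstimate p (-t) = meanEstimate p t := by
  have hodd : Odd (p - 1) := Nat.Even.sub_odd hp1 hp odd_one
  unfold meanEstimate
  simp only [artanh_neg_eq, hodd.neg_pow, mul_neg, neg_div_neg_eq, neg_eq_zero, abs_neg]

lemma tendsto_artanh_div_self : Tendsto (fun t => Real.artanh t / t) (𝓝[≠] 0) (𝓝 1) := by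
  have h := hasDerivAt_iff_tendsto_slope.1 (hasDerivAt_artanh (t := 0) (by simp))
  simp only [ne_eq, OfNat.ofNat_ne_zero, not_false_eq_true, zero_pow, sub_zero, div_one] at h
  refine h.congr fun t => ?_
  rw [slope_def_field, Real.artanh_zero, sub_zero, sub_zero]

lemma tendsto_sqrt_fst {z : ℝ} :
    Tendsto (fun a : ℕ × ℝ => √(a.1 : ℝ)) (atTop ×ˢ 𝓝 z) atTop :=
  Real.tendsto_sqrt_atTop.comp (tendsto_natCast_atTop_atTop.comp tendsto_fst)

lemma tendsto_snd_div {s : ℕ → ℝ} (hs : Tendsto s atTop atTop) {z : ℝ} (hz : z ≠ 0) :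
    Tendsto (fun a : ℕ × ℝ => a.2 / s a.1) (atTop ×ˢ 𝓝 z) (𝓝[≠] 0) := by
  have hs' : Tendsto (fun a : ℕ × ℝ => s a.1) (atTop ×ˢ 𝓝 z) atTop := hs.comp tendsto_fst
  refine tendsto_nhdsWithin_iff.2 ⟨tendsto_snd.div_atTop hs', ?_⟩
  filter_upwards [tendsto_snd.eventually (isOpen_ne.mem_nhds hz), hs'.eventually_gt_atTop 0]
    with a h1 h2
  exact div_ne_zero h1 h2.ne'

lemma rpow_one_sub_half {p : ℕ} (hp : 2 ≤ p) {N : ℕ} (hN : 0 < N) :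
    (N : ℝ) ^ (1 - (p : ℝ) / 2) = (√(N : ℝ) ^ (p - 2))⁻¹ := by
  have hN' : (0 : ℝ) < N := by positivity
  rw [Real.sqrt_eq_rpow, ← Real.rpow_natCast, ← Real.rpow_mul hN'.le, ← Real.rpow_neg hN'.le]
  congr 1
  push_cast [hp]
  ring

lemma meanEstimate_of_nonneg {p : ℕ} {t : ℝ} (h0 : t ≠ 0) (h1 : |t| < 1)
    (h2 : 0 ≤ Real.artanh t / (p * t ^ (p - 1))) :
    meanEstimate p t = ((Real.artanh t / (p * t ^ (p - 1)) : ℝ) : EReal) := by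
  rw [meanEstimate, if_neg h0, if_pos ⟨h1, h2⟩]

/-- The ratio is nonnegative for small `t`: for even `p`, `artanh t` and `t^(p-1)` have the same
sign; otherwise `t > 0`. -/
lemma eventually_meanEstimate_eq {p : ℕ} (hp : 1 ≤ p) {s : ℕ → ℝ} (hs : Tendsto s atTop atTop)
    {z : ℝ} (hz : z ≠ 0) (hpz : Even p ∨ 0 < z) :
    ∀ᶠ a : ℕ × ℝ in atTop ×ˢ 𝓝 z, meanEstimate p (a.2 / s a.1) =
      ((Real.artanh (a.2 / s a.1) / (p * (a.2 / s a.1) ^ (p - 1)) : ℝ) : EReal) := by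
  have ht := tendsto_snd_div hs hz
  have hs' : Tendsto (fun a : ℕ × ℝ => s a.1) (atTop ×ˢ 𝓝 z) atTop := hs.comp tendsto_fst
  have hball := (tendsto_nhdsWithin_iff.1 ht).1.eventually (Metric.ball_mem_nhds 0 one_pos)
  have hpos : ∀ᶠ a : ℕ × ℝ in atTop ×ˢ 𝓝 z, Even p ∨ 0 < a.2 := by
    rcases hpz with h | h
    · exact Eventually.of_forall fun _ => Or.inl h
    · filter_upwards [tendsto_snd.eventually (lt_mem_nhds h)] with a ha using Or.inr ha
  filter_upwards [(tendsto_nhdsWithin_iff.1 ht).2, hball, hpos, hs'.eventually_gt_atTop 0]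
    with a h0 h1 h2 h3
  set t := a.2 / s a.1 with htdef
  have h1' : |t| < 1 := by simpa using h1
  refine meanEstimate_of_nonneg h0 h1' ?_
  rcases lt_or_gt_of_ne (show t ≠ 0 from h0) with h | h
  · have hpe : Even p := h2.resolve_right fun h4 => absurd (div_pos h4 h3) (not_lt.2 h.le)
    have hodd : Odd (p - 1) := Nat.Even.sub_odd hp hpe odd_one
    exact div_nonneg_of_nonpos (Real.artanh_nonpos h.le)
      (mul_nonpos_of_nonneg_of_nonpos p.cast_nonneg (hodd.pow_nonpos h.le))
  · exact div_nonneg (Real.artanh_nonneg h.le) (by positivity)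

/-- For odd `p` and `t < 0` the ratio is negative, so no admissible `b` exists. This is the source
of the atom at `∞` on the fine scale. -/
lemma eventually_meanEstimate_eq_top {p : ℕ} (hp : Odd p) {z : ℝ} (hz : z < 0) :
    ∀ᶠ a : ℕ × ℝ in atTop ×ˢ 𝓝 z, meanEstimate p (a.2 / √(a.1 : ℝ)) = ⊤ := by
  have ht := tendsto_snd_div (Real.tendsto_sqrt_atTop.comp tendsto_natCast_atTop_atTop) hz.ne
  have hball := (tendsto_nhdsWithin_iff.1 ht).1.eventually (Metric.ball_mem_nhds 0 one_pos)
  filter_upwards [hball, tendsto_snd.eventually (gt_mem_nhds hz),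
    tendsto_sqrt_fst.eventually_gt_atTop 0] with a h1 h2 h3
  have hneg : a.2 / √(a.1 : ℝ) < 0 := div_neg_of_neg_of_pos h2 h3
  have h1' : |a.2 / √(a.1 : ℝ)| < 1 := mem_ball_zero_iff.1 h1
  rw [meanEstimate, if_neg hneg.ne, if_neg]
  rintro ⟨-, h4⟩
  have heven : Even (p - 1) := Nat.Odd.sub_odd hp odd_one
  have h5 : 0 < (p : ℝ) * (a.2 / √(a.1 : ℝ)) ^ (p - 1) :=
    mul_pos (by exact_mod_cast hp.pos) (heven.pow_pos hneg.ne)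
  exact absurd (div_neg_of_neg_of_pos (Real.artanh_neg ⟨(abs_lt.1 h1').1, hneg⟩) h5) (not_lt.2 h4)

/-- As `artanh t ~ t`, the ratio is asymptotic to `1 / (p t^(p-2))`; with `t = z / √N` the powers of
`√N` cancel. -/
lemma tendsto_scaled_ratio_zero {p : ℕ} (hp : 2 ≤ p) {z : ℝ} (hz : z ≠ 0) :
    Tendsto (fun a : ℕ × ℝ => (√(a.1 : ℝ) ^ (p - 2))⁻¹ *
      (Real.artanh (a.2 / √(a.1 : ℝ)) / (p * (a.2 / √(a.1 : ℝ)) ^ (p - 1)))) (atTop ×ˢ 𝓝 z)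
      (𝓝 (1 / (p * z ^ (p - 2)))) := by
  have hpR : (0 : ℝ) < p := by positivity
  have ht := tendsto_snd_div (Real.tendsto_sqrt_atTop.comp tendsto_natCast_atTop_atTop) hz
  have h1 := tendsto_artanh_div_self.comp ht
  have h2 : Tendsto (fun a : ℕ × ℝ => (p : ℝ) * a.2 ^ (p - 2)) (atTop ×ˢ 𝓝 z)
      (𝓝 (p * z ^ (p - 2))) := (tendsto_snd.pow _).const_mul _
  refine (h1.div h2 (mul_ne_zero hpR.ne' (pow_ne_zero _ hz))).congr' ?_
  filter_upwards [tendsto_snd.eventually (isOpen_ne.mem_nhds hz),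
    tendsto_sqrt_fst.eventually_gt_atTop 0] with a h3 h4
  have h3' : a.2 ≠ 0 := h3
  have hpow : (a.2 / √(a.1 : ℝ)) ^ (p - 1) =
      a.2 ^ (p - 2) / √(a.1 : ℝ) ^ (p - 2) * (a.2 / √(a.1 : ℝ)) := by
    rw [← div_pow, ← pow_succ]; congr 1; omega
  simp only [Pi.div_apply, Function.comp_apply]
  rw [hpow]
  field_simp

lemma tendsto_fineScale_zero {p : ℕ} (hp : 3 ≤ p) {z : ℝ} (hz : z ≠ 0) :
    Tendsto (fun a : ℕ × ℝ => (((a.1 : ℝ) ^ (1 - (p : ℝ) / 2) : ℝ) : EReal) *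
      meanEstimate p (0 + a.2 / √(a.1 : ℝ))) (atTop ×ˢ 𝓝 z)
      (𝓝 (if Even p ∨ 0 < z then ((1 / (p * z ^ (p - 2)) : ℝ) : EReal) else ⊤)) := by
  have hN : ∀ᶠ a : ℕ × ℝ in atTop ×ˢ 𝓝 z, 0 < a.1 := tendsto_fst.eventually_gt_atTop 0
  split_ifs with h
  · have h1 := (continuous_coe_real_ereal.tendsto _).comp
      (tendsto_scaled_ratio_zero (show 2 ≤ p by omega) hz)
    refine h1.congr' ?_
    filter_upwards [hN, eventually_meanEstimate_eq (show 1 ≤ p by omega)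
      (Real.tendsto_sqrt_atTop.comp tendsto_natCast_atTop_atTop) hz h] with a h2 h3
    simp only [Function.comp_apply] at h3
    rw [zero_add, h3, rpow_one_sub_half (by omega) h2, Function.comp_apply, EReal.coe_mul]
  · rw [not_or, Nat.not_even_iff_odd, not_lt] at h
    refine tendsto_const_nhds.congr' ?_
    filter_upwards [hN, eventually_meanEstimate_eq_top h.1 (lt_of_le_of_ne h.2 hz)] with a h2 h3
    rw [zero_add, h3, EReal.coe_mul_top_of_pos]
    have : (0 : ℝ) < a.1 := by positivity
    positivity

/-- Near `0` the estimate either grows like `√N^(p-2)` or equals `∞`, so subtracting `β` does not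
matter. -/
lemma tendsto_sqrtScale_zero {p : ℕ} (hp : 3 ≤ p) (β : ℝ) {z : ℝ} (hz : z ≠ 0) :
    Tendsto (fun a : ℕ × ℝ => ((√(a.1 : ℝ) : ℝ) : EReal) *
      (meanEstimate p (0 + a.2 / √(a.1 : ℝ)) - (β : EReal))) (atTop ×ˢ 𝓝 z) (𝓝 ⊤) := by
  have hsq := tendsto_sqrt_fst (z := z)
  by_cases h : Even p ∨ 0 < z
  · have hlim := tendsto_scaled_ratio_zero (show 2 ≤ p by omega) hz
    have hpos : 0 < 1 / (p * z ^ (p - 2)) := by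
      have : 0 < z ^ (p - 2) := by
        rcases h with h | h
        · exact ((Nat.even_sub (by omega)).2 (by simp [h])).pow_pos hz
        · positivity
      positivity
    have hpow : Tendsto (fun a : ℕ × ℝ => √(a.1 : ℝ) ^ (p - 2)) (atTop ×ˢ 𝓝 z) atTop :=
      (tendsto_pow_atTop (by omega)).comp hsq
    have h1 := hsq.atTop_mul_atTop₀ (tendsto_atTop_add_const_right _ (-β)
      (hpow.atTop_mul_pos hpos hlim))
    refine (EReal.tendsto_coe_nhds_top_iff.2 h1).congr' ?_
    filter_upwards [hsq.eventually_gt_atTop 0, eventually_meanEstimate_eq (show 1 ≤ p by omega)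
      (Real.tendsto_sqrt_atTop.comp tendsto_natCast_atTop_atTop) hz h] with a h2 h3
    simp only [Function.comp_apply] at h3
    rw [zero_add, h3, mul_inv_cancel_left₀ (pow_pos h2 _).ne', ← sub_eq_add_neg, EReal.coe_mul,
      EReal.coe_sub]
  · rw [not_or, Nat.not_even_iff_odd, not_lt] at h
    refine tendsto_const_nhds.congr' ?_
    filter_upwards [hsq.eventually_gt_atTop 0,
      eventually_meanEstimate_eq_top h.1 (lt_of_le_of_ne h.2 hz)] with a h2 h3
    rw [zero_add, h3, EReal.top_sub_coe, EReal.coe_mul_top_of_pos h2]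

lemma tendsto_add_snd_div_sqrt (m z : ℝ) :
    Tendsto (fun a : ℕ × ℝ => m + a.2 / √(a.1 : ℝ)) (atTop ×ˢ 𝓝 z) (𝓝 m) := by
  simpa using tendsto_const_nhds.add ((tendsto_snd (f := atTop) (g := 𝓝 z)).div_atTop
    (tendsto_sqrt_fst (z := z)))

lemma eventually_meanEstimate_eq_at {p : ℕ} {m : ℝ} (hm : m ∈ Set.Ioo (0 : ℝ) 1) (z : ℝ) :
    ∀ᶠ a : ℕ × ℝ in atTop ×ˢ 𝓝 z, meanEstimate p (m + a.2 / √(a.1 : ℝ)) =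
      ((Real.artanh (m + a.2 / √(a.1 : ℝ)) / (p * (m + a.2 / √(a.1 : ℝ)) ^ (p - 1)) : ℝ) :
        EReal) := by
  filter_upwards [(tendsto_add_snd_div_sqrt m z).eventually (isOpen_Ioo.mem_nhds hm)] with a ha
  have h0 := ha.1
  refine meanEstimate_of_nonneg ha.1.ne' ?_ ?_
  · rw [abs_of_pos ha.1]; exact ha.2
  · exact div_nonneg (Real.artanh_nonneg ha.1.le) (by positivity)

/-- The derivative at `m` of the estimate as a function of the mean spin. -/
lemma hasDerivAt_ratio {p : ℕ} (hp : 3 ≤ p) {m : ℝ}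
    (h : IsPositiveMaximizer p (curieWeissThreshold p) m) :
    HasDerivAt (fun t => Real.artanh t / (p * t ^ (p - 1)))
      (-thresholdCurvature p m / (p * m ^ (p - 1))) m := by
  have h1 := h.lt_one (curieWeissThreshold_spec hp).1
  have hm0 := h.1
  have hm : m ∈ Set.Ioo (-1 : ℝ) 1 := ⟨by linarith, h1⟩
  have hpR : (0 : ℝ) < p := by positivity
  have hc := h.critical h1
  refine ((hasDerivAt_artanh hm).div ((hasDerivAt_pow (p - 1) m).const_mul (p : ℝ))
    (by positivity)).congr_deriv ?_
  rw [thresholdCurvature, deriv_deriv_curieWeissG p _ hm, ← hc, show p - 1 - 1 = p - 2 by omega]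
  have : 0 < 1 - m ^ 2 := by nlinarith
  field_simp
  ring

lemma ratio_eq_threshold {p : ℕ} (hp : 3 ≤ p) {m : ℝ}
    (h : IsPositiveMaximizer p (curieWeissThreshold p) m) :
    Real.artanh m / (p * m ^ (p - 1)) = curieWeissThreshold p := by
  have hm0 := h.1
  have hpR : (0 : ℝ) < p := by positivity
  rw [← h.critical (h.lt_one (curieWeissThreshold_spec hp).1)]
  field_simp

/-- The delta method at `m`, where the estimate equals `β`. -/
lemma tendsto_sqrtScale_maximizer {p : ℕ} (hp : 3 ≤ p) {m : ℝ}
    (h : IsPositiveMaximizer p (curieWeissThreshold p) m) (z : ℝ) :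
    Tendsto (fun a : ℕ × ℝ => ((√(a.1 : ℝ) : ℝ) : EReal) *
      (meanEstimate p (m + a.2 / √(a.1 : ℝ)) - (curieWeissThreshold p : EReal))) (atTop ×ˢ 𝓝 z)
      (𝓝 ((-thresholdCurvature p m / (p * m ^ (p - 1)) * z : ℝ) : EReal)) := by
  set η := fun t => Real.artanh t / (p * t ^ (p - 1)) with hη
  obtain ⟨D, hD⟩ : ∃ D, D = -thresholdCurvature p m / (p * m ^ (p - 1)) := ⟨_, rfl⟩
  have hsq := tendsto_sqrt_fst (z := z)
  have ht := tendsto_add_snd_div_sqrt m z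
  have hd := hasDerivAt_ratio hp h
  rw [← hD] at hd ⊢
  replace hd := hd.isLittleO.comp_tendsto ht
  have hreal : Tendsto (fun a : ℕ × ℝ => √(a.1 : ℝ) * (η (m + a.2 / √(a.1 : ℝ)) - η m))
      (atTop ×ˢ 𝓝 z) (𝓝 (D * z)) := by
    -- Multiplying the differentiability remainder `o(z' / √N)` by `√N` leaves `o(z')`, and `z'`
    -- stays bounded near `z`.
    have h1 : (fun a : ℕ × ℝ => √(a.1 : ℝ) * (η (m + a.2 / √(a.1 : ℝ)) - η m) - D * a.2)
        =o[atTop ×ˢ 𝓝 z] fun a => a.2 := by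
      refine ((Asymptotics.isBigO_refl (fun a : ℕ × ℝ => √(a.1 : ℝ)) _).mul_isLittleO hd).congr' ?_ ?_
      · filter_upwards [hsq.eventually_gt_atTop 0] with a ha
        simp only [Function.comp_apply, add_sub_cancel_left, smul_eq_mul, hη]
        field_simp
      · filter_upwards [hsq.eventually_gt_atTop 0] with a ha
        simp only [Function.comp_apply, add_sub_cancel_left]
        field_simp
    have h2 : Tendsto (fun a : ℕ × ℝ => √(a.1 : ℝ) * (η (m + a.2 / √(a.1 : ℝ)) - η m) - D * a.2)
        (atTop ×ˢ 𝓝 z) (𝓝 0) := by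
      rw [← Asymptotics.isLittleO_one_iff ℝ]
      exact h1.trans_isBigO ((tendsto_snd (f := atTop) (g := 𝓝 z)).isBigO_one ℝ)
    have h3 := h2.add ((tendsto_snd (f := (atTop : Filter ℕ)) (g := 𝓝 z)).const_mul D)
    simpa using h3
  refine ((continuous_coe_real_ereal.tendsto _).comp hreal).congr' ?_
  filter_upwards [eventually_meanEstimate_eq_at (p := p)
    ⟨h.1, h.lt_one (curieWeissThreshold_spec hp).1⟩ z] with a ha
  rw [ha, Function.comp_apply, EReal.coe_mul, EReal.coe_sub,
    show η m = curieWeissThreshold p from ratio_eq_threshold hp h]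

/-- The estimate stays near `β` while the scaling factor `√N^(-(p-2))` tends to `0`. -/
lemma tendsto_fineScale_maximizer {p : ℕ} (hp : 3 ≤ p) {m : ℝ}
    (h : IsPositiveMaximizer p (curieWeissThreshold p) m) (z : ℝ) :
    Tendsto (fun a : ℕ × ℝ => (((a.1 : ℝ) ^ (1 - (p : ℝ) / 2) : ℝ) : EReal) *
      meanEstimate p (m + a.2 / √(a.1 : ℝ))) (atTop ×ˢ 𝓝 z) (𝓝 0) := by
  have h1 := (hasDerivAt_ratio hp h).continuousAt.tendsto.comp (tendsto_add_snd_div_sqrt m z)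
  have h2 : Tendsto (fun a : ℕ × ℝ => (√(a.1 : ℝ) ^ (p - 2))⁻¹) (atTop ×ˢ 𝓝 z) (𝓝 0) :=
    tendsto_inv_atTop_zero.comp ((tendsto_pow_atTop (by omega)).comp tendsto_sqrt_fst)
  have h3 := h2.mul h1
  rw [zero_mul] at h3
  have h4 := (continuous_coe_real_ereal.tendsto _).comp h3
  rw [EReal.coe_zero] at h4
  refine h4.congr' ?_
  have hN : ∀ᶠ a : ℕ × ℝ in atTop ×ˢ 𝓝 z, 0 < a.1 := tendsto_fst.eventually_gt_atTop 0
  filter_upwards [hN, eventually_meanEstimate_eq_at (p := p)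
    ⟨h.1, h.lt_one (curieWeissThreshold_spec hp).1⟩ z] with a ha ha'
  rw [ha', rpow_one_sub_half (by omega) ha, Function.comp_apply, Function.comp_apply,
    EReal.coe_mul]

/-! ### Limit laws for `p ≥ 3` -/

lemma tendstoInDistribution_of_meanSpin {p : ℕ} {X : ∀ N, SpinConfig N → EReal}
    {Y : ℕ → ℝ → EReal} {ν : Measure EReal} [IsProbabilityMeasure ν]
    (hXY : ∀ N, 0 < N → ∀ x : SpinConfig N, X N x = Y N (meanSpin x))
    (h : ∀ F : BoundedContinuousFunction EReal ℝ,
      Tendsto (fun N => ∫ x, F (Y N (meanSpin x)) ∂thresholdMeasure p N) atTop (𝓝 (∫ y, F y ∂ν))) :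
    TendstoInDistribution X atTop (id : EReal → EReal) (fun N => thresholdMeasure p N) ν where
  forall_aemeasurable N := (measurable_of_finite _).aemeasurable
  tendsto := by
    refine ProbabilityMeasure.tendsto_iff_forall_integral_tendsto.2 fun F => ?_
    have h1 := h F
    simp only [ProbabilityMeasure.coe_mk, Measure.map_id]
    refine h1.congr' ?_
    filter_upwards [eventually_gt_atTop 0] with N hN
    rw [integral_map (measurable_of_finite _).aemeasurable
      F.continuous.measurable.aestronglyMeasurable]
    simp only [hXY N hN]

lemma integral_smul_add_smul {μ ν : Measure EReal} [IsFiniteMeasure μ] [IsFiniteMeasure ν]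
    {a b : ℝ} (ha : 0 ≤ a) (hb : 0 ≤ b) (F : BoundedContinuousFunction EReal ℝ) :
    ∫ y, F y ∂(ENNReal.ofReal a • μ + ENNReal.ofReal b • ν) =
      a * ∫ y, F y ∂μ + b * ∫ y, F y ∂ν := by
  rw [integral_add_measure ((F.integrable μ).smul_measure ENNReal.ofReal_ne_top)
    ((F.integrable ν).smul_measure ENNReal.ofReal_ne_top), integral_smul_measure,
    integral_smul_measure, ENNReal.toReal_ofReal ha, ENNReal.toReal_ofReal hb, smul_eq_mul,
    smul_eq_mul]

lemma ae_ne_zero : ∀ᵐ z : ℝ, z ≠ 0 := by simp [ae_iff]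

theorem tendstoInDistribution_sqrtScale {p : ℕ} (hp : 3 ≤ p) {m : ℝ}
    (hm : IsPositiveMaximizer p (curieWeissThreshold p) m) :
    TendstoInDistribution
      (fun (N : ℕ) (x : SpinConfig N) => ((√(N : ℝ) : ℝ) : EReal) *
        (mplEstimate (curieWeissTensor p N) x - (curieWeissThreshold p : EReal)))
      atTop (id : EReal → EReal) (fun N => thresholdMeasure p N) (sqrtScaleLimit p m) := by
  have hcurv := thresholdCurvature_neg hp hm
  have hm0 := hm.1
  have hpR : (0 : ℝ) < p := by positivity
  refine tendstoInDistribution_of_meanSpin (Y := fun N t => ((√(N : ℝ) : ℝ) : EReal) *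
    (meanEstimate p t - (curieWeissThreshold p : EReal)))
    (fun N hN x => by rw [mplEstimate_curieWeissTensor (by omega) hN]) fun F => ?_
  have key := tendsto_integral_threshold hp hm (M := ‖F‖)
    (G := fun N t => F (((√(N : ℝ) : ℝ) : EReal) *
      (meanEstimate p t - (curieWeissThreshold p : EReal))))
    (f₀ := fun _ => F ⊤)
    (f₁ := fun z => F ((-thresholdCurvature p m / (p * m ^ (p - 1)) * z : ℝ) : EReal))
    (fun N t => F.norm_coe_le_norm _)
    (fun he N t => by rw [meanEstimate_neg he (by omega)])
    (by filter_upwards [ae_ne_zero] with z hz using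
      (F.continuous.tendsto _).comp (tendsto_sqrtScale_zero hp _ hz))
    (Eventually.of_forall fun z =>
      (F.continuous.tendsto _).comp (tendsto_sqrtScale_maximizer hp hm z))
  convert! key using 2
  have hprob : IsProbabilityMeasure ((gaussianReal 0 (-thresholdCurvature p m /
      ((p : ℝ) ^ 2 * m ^ (2 * p - 2))).toNNReal).map (fun y : ℝ => (y : EReal))) :=
    Measure.isProbabilityMeasure_map measurable_coe_real_ereal.aemeasurable
  rw [sqrtScaleLimit, integral_smul_add_smul (by linarith [mixtureWeight_le_one p m])
    (mixtureWeight_nonneg p m), integral_dirac, integral_map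
    measurable_coe_real_ereal.aemeasurable F.continuous.measurable.aestronglyMeasurable]
  set c := -thresholdCurvature p m / (p * m ^ (p - 1)) with hc
  -- Scaling a Gaussian of variance `1 / -g''(m)` by the delta-method slope `c` gives `c^2 / -g''(m)
  -- = -g''(m) / (p^2 m^(2p-2))`.
  have hvar : (-thresholdCurvature p m / ((p : ℝ) ^ 2 * m ^ (2 * p - 2))).toNNReal =
      NNReal.mk (c ^ 2) (sq_nonneg c) * (1 / -thresholdCurvature p m).toNNReal := by
    have h1 : 0 < -thresholdCurvature p m := by linarith
    apply NNReal.eq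
    rw [NNReal.coe_mul, Real.coe_toNNReal _ (by positivity), Real.coe_toNNReal _ (by positivity),
      NNReal.coe_mk, hc, show 2 * p - 2 = (p - 1) * 2 by omega, pow_mul]
    field_simp
  have hmap := gaussianReal_map_const_mul (μ := 0)
    (v := (1 / -thresholdCurvature p m).toNNReal) c
  rw [mul_zero] at hmap
  have hFmeas : Measurable fun y : ℝ => F (y : EReal) :=
    F.continuous.measurable.comp measurable_coe_real_ereal
  rw [hvar, ← hmap, integral_map (by fun_prop) hFmeas.aestronglyMeasurable]
  simp only [integral_const, probReal_univ, smul_eq_mul, one_mul]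
  ring

theorem tendstoInDistribution_fineScale_even {p : ℕ} (hp : 3 ≤ p) {m : ℝ}
    (hm : IsPositiveMaximizer p (curieWeissThreshold p) m) (hpe : Even p) :
    TendstoInDistribution
      (fun (N : ℕ) (x : SpinConfig N) =>
        (((N : ℝ) ^ (1 - (p : ℝ) / 2) : ℝ) : EReal) * mplEstimate (curieWeissTensor p N) x)
      atTop (id : EReal → EReal) (fun N => thresholdMeasure p N) (fineScaleLimitEven p m) := by
  refine tendstoInDistribution_of_meanSpin (Y := fun N t =>
    (((N : ℝ) ^ (1 - (p : ℝ) / 2) : ℝ) : EReal) * meanEstimate p t)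
    (fun N hN x => by rw [mplEstimate_curieWeissTensor (by omega) hN]) fun F => ?_
  have key := tendsto_integral_threshold hp hm (M := ‖F‖)
    (G := fun N t => F ((((N : ℝ) ^ (1 - (p : ℝ) / 2) : ℝ) : EReal) * meanEstimate p t))
    (f₀ := fun z => F ((1 / (p * z ^ (p - 2)) : ℝ) : EReal)) (f₁ := fun _ => F 0)
    (fun N t => F.norm_coe_le_norm _)
    (fun he N t => by rw [meanEstimate_neg he (by omega)])
    (by
      filter_upwards [ae_ne_zero] with z hz
      have := tendsto_fineScale_zero hp hz
      rw [if_pos (Or.inl hpe)] at this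
      exact (F.continuous.tendsto _).comp this)
    (Eventually.of_forall fun z =>
      (F.continuous.tendsto _).comp (tendsto_fineScale_maximizer hp hm z))
  convert! key using 2
  have hmeas : Measurable fun z : ℝ => ((1 / (p * z ^ (p - 2)) : ℝ) : EReal) := by fun_prop
  have hprob := Measure.isProbabilityMeasure_map (μ := gaussianReal 0 1) hmeas.aemeasurable
  rw [fineScaleLimitEven, integral_smul_add_smul (mixtureWeight_nonneg p m)
    (by linarith [mixtureWeight_le_one p m]), integral_dirac, integral_map
    hmeas.aemeasurable F.continuous.measurable.aestronglyMeasurable]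
  simp

theorem tendstoInDistribution_fineScale_odd {p : ℕ} (hp : 3 ≤ p) {m : ℝ}
    (hm : IsPositiveMaximizer p (curieWeissThreshold p) m) (hpo : Odd p) :
    TendstoInDistribution
      (fun (N : ℕ) (x : SpinConfig N) =>
        (((N : ℝ) ^ (1 - (p : ℝ) / 2) : ℝ) : EReal) * mplEstimate (curieWeissTensor p N) x)
      atTop (id : EReal → EReal) (fun N => thresholdMeasure p N) (fineScaleLimitOdd p m) := by
  have hne : ¬ Even p := Nat.not_even_iff_odd.2 hpo
  refine tendstoInDistribution_of_meanSpin (Y := fun N t =>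
    (((N : ℝ) ^ (1 - (p : ℝ) / 2) : ℝ) : EReal) * meanEstimate p t)
    (fun N hN x => by rw [mplEstimate_curieWeissTensor (by omega) hN]) fun F => ?_
  set y : ℝ → EReal := fun z => if 0 < z then ((1 / (p * |z| ^ (p - 2)) : ℝ) : EReal) else ⊤
    with hy
  have key := tendsto_integral_threshold hp hm (M := ‖F‖)
    (G := fun N t => F ((((N : ℝ) ^ (1 - (p : ℝ) / 2) : ℝ) : EReal) * meanEstimate p t))
    (f₀ := fun z => F (y z)) (f₁ := fun _ => F 0)
    (fun N t => F.norm_coe_le_norm _) (fun he => absurd he hne)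
    (by
      filter_upwards [ae_ne_zero] with z hz
      have h1 := tendsto_fineScale_zero hp hz
      have h2 : (if Even p ∨ 0 < z then ((1 / (p * z ^ (p - 2)) : ℝ) : EReal) else ⊤) = y z := by
        rw [hy]
        by_cases h : 0 < z
        · simp [h, abs_of_pos h]
        · simp [h, hne]
      rw [h2] at h1
      exact (F.continuous.tendsto _).comp h1)
    (Eventually.of_forall fun z =>
      (F.continuous.tendsto _).comp (tendsto_fineScale_maximizer hp hm z))
  convert! key using 2
  have hmeas : Measurable fun z : ℝ => ((1 / (p * |z| ^ (p - 2)) : ℝ) : EReal) := by fun_prop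
  have hymeas : Measurable y := Measurable.ite measurableSet_Ioi hmeas measurable_const
  have hprob := Measure.isProbabilityMeasure_map (μ := gaussianReal 0 1) hmeas.aemeasurable
  have hint : ∀ u : ℝ → EReal, Measurable u → Integrable (fun z => F (u z)) (gaussianReal 0 1) :=
    fun u hu => Integrable.of_bound (F.continuous.measurable.comp hu).aestronglyMeasurable ‖F‖
      (Eventually.of_forall fun z => F.norm_coe_le_norm _)
  -- Averaging over `z` and `-z`: exactly one sign gives the finite value and the other gives `∞`,
  -- so the mass `α` splits into halves.
  have hhalf : 2 * ∫ z, F (y z) ∂gaussianReal 0 1 =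
      ∫ z, F ((1 / (p * |z| ^ (p - 2)) : ℝ) : EReal) ∂gaussianReal 0 1 + F ⊤ := by
    have h1 : ∫ _ : ℝ, F ⊤ ∂gaussianReal 0 1 = F ⊤ := by simp
    rw [two_mul]
    nth_rewrite 2 [← integral_gaussianReal_comp_neg]
    rw [← integral_add (hint y hymeas) (hint (fun z => y (-z)) (hymeas.comp measurable_neg)),
      ← h1, ← integral_add (hint _ hmeas) (integrable_const _)]
    have h0 : ∀ᵐ z ∂gaussianReal 0 1, z ≠ 0 :=
      (gaussianReal_absolutelyContinuous 0 one_ne_zero).ae_le ae_ne_zero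
    refine integral_congr_ae ?_
    filter_upwards [h0] with z hz
    rcases lt_or_gt_of_ne hz with h | h
    · simp [hy, h, h.not_gt, add_comm]
    · simp [hy, h, h.not_gt]
  have hα := mixtureWeight_nonneg p m
  have hα1 := mixtureWeight_le_one p m
  have hsplit : fineScaleLimitOdd p m = ENNReal.ofReal 1 • (ENNReal.ofReal (mixtureWeight p m / 2) •
      (gaussianReal 0 1).map (fun z : ℝ => ((1 / (p * |z| ^ (p - 2)) : ℝ) : EReal)) +
      ENNReal.ofReal (mixtureWeight p m / 2) • Measure.dirac ⊤) +
      ENNReal.ofReal (1 - mixtureWeight p m) • Measure.dirac 0 := by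
    rw [ENNReal.ofReal_one, one_smul]; rfl
  have hf1 : IsFiniteMeasure (ENNReal.ofReal (mixtureWeight p m / 2) •
      (gaussianReal 0 1).map (fun z : ℝ => ((1 / (p * |z| ^ (p - 2)) : ℝ) : EReal))) :=
    Measure.smul_finite _ ENNReal.ofReal_ne_top
  have hf2 : IsFiniteMeasure (ENNReal.ofReal (mixtureWeight p m / 2) •
      (Measure.dirac ⊤ : Measure EReal)) :=
    Measure.smul_finite _ ENNReal.ofReal_ne_top
  rw [hsplit, integral_smul_add_smul zero_le_one (by linarith),
    integral_smul_add_smul (by linarith) (by linarith), integral_dirac, integral_dirac,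
    integral_map hmeas.aemeasurable F.continuous.measurable.aestronglyMeasurable]
  simp only [integral_const, probReal_univ, smul_eq_mul, one_mul]
  linear_combination (-mixtureWeight p m / 2) * hhalf

/-! ### The case `p = 2` -/

/-- By the cubic expansion of `artanh`, `artanh t / (2 t) - 1/2 ~ t^2 / 6`, and `√N t^2 = z^2` for
`t = z N^(-1/4)`. -/
lemma tendsto_quarticScale {z : ℝ} (hz : z ≠ 0) :
    Tendsto (fun a : ℕ × ℝ => ((√(a.1 : ℝ) : ℝ) : EReal) *
      (meanEstimate 2 (0 + a.2 / √√(a.1 : ℝ)) - ((1 / 2 : ℝ) : EReal))) (atTop ×ˢ 𝓝 z)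
      (𝓝 ((z ^ 2 / 6 : ℝ) : EReal)) := by
  have hs : Tendsto (fun N : ℕ => √√(N : ℝ)) atTop atTop :=
    Real.tendsto_sqrt_atTop.comp (Real.tendsto_sqrt_atTop.comp tendsto_natCast_atTop_atTop)
  have ht := tendsto_snd_div hs hz
  have h1 : Tendsto (fun t : ℝ => (t - Real.artanh t + t ^ 3 / 3) / t ^ 3) (𝓝[≠] 0) (𝓝 0) :=
    artanh_zero_quartic.tendsto_div_nhds_zero.mono_left nhdsWithin_le_nhds
  have h2 : Tendsto (fun a : ℕ × ℝ => a.2 ^ 2) (atTop ×ˢ 𝓝 z) (𝓝 (z ^ 2)) := tendsto_snd.pow 2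
  have h3 := (h2.mul ((tendsto_const_nhds (x := (1 / 3 : ℝ))).sub (h1.comp ht))).div_const 2
  rw [sub_zero, show z ^ 2 * (1 / 3) / 2 = z ^ 2 / 6 by ring] at h3
  refine ((continuous_coe_real_ereal.tendsto _).comp h3).congr' ?_
  have hs' : Tendsto (fun a : ℕ × ℝ => √√(a.1 : ℝ)) (atTop ×ˢ 𝓝 z) atTop := hs.comp tendsto_fst
  filter_upwards [eventually_meanEstimate_eq (p := 2) (by norm_num) hs hz (Or.inl even_two),
    (tendsto_nhdsWithin_iff.1 ht).2, hs'.eventually_gt_atTop 0] with a h4 h5 h6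
  rw [zero_add, h4, ← EReal.coe_sub, ← EReal.coe_mul]
  simp only [Function.comp_apply]
  congr 1
  have h7 : √(a.1 : ℝ) = √√(a.1 : ℝ) ^ 2 := (Real.sq_sqrt (Real.sqrt_nonneg _)).symm
  set s := √√(a.1 : ℝ)
  set t := a.2 / s with htdef
  have h8 : a.2 = s * t := by rw [htdef]; field_simp
  have h9 : t ≠ 0 := h5
  rw [h7, h8]
  push_cast
  field_simp
  ring

lemma integrable_exp_neg_quartic : Integrable fun z : ℝ => Real.exp (-z ^ 4 / 12) := by
  -- The majorant `exp (1/12) exp (-z^2 / 6)` comes from `z^4 ≥ 2 z^2 - 1`.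
  have h := (integrable_exp_neg_mul_sq (show (0 : ℝ) < 1 / 6 by norm_num)).const_mul
    (Real.exp (1 / 12))
  refine h.mono' (by fun_prop) (Eventually.of_forall fun z => ?_)
  rw [Real.norm_of_nonneg (Real.exp_pos _).le, ← Real.exp_add, Real.exp_le_exp]
  nlinarith [sq_nonneg (z ^ 2 - 1)]

lemma integral_quartic_indicator (t : ℝ) :
    ∫ z : ℝ, (if z ^ 2 / 6 ≤ t then 1 else 0) * Real.exp (-z ^ 4 / 12) =
      if 0 ≤ t then (∫ z in Set.Iic √(6 * t), Real.exp (-z ^ 4 / 12)) -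
        ∫ z in Set.Iic (-√(6 * t)), Real.exp (-z ^ 4 / 12) else 0 := by
  split_ifs with h
  · have hiff : ∀ z : ℝ, z ^ 2 / 6 ≤ t ↔ z ∈ Set.Icc (-√(6 * t)) √(6 * t) := fun z => by
      rw [Set.mem_Icc, ← abs_le, ← Real.sqrt_sq_eq_abs, Real.sqrt_le_sqrt_iff (by positivity),
        div_le_iff₀ (by norm_num), mul_comm]
    rw [intervalIntegral.integral_Iic_sub_Iic integrable_exp_neg_quartic.integrableOn
      integrable_exp_neg_quartic.integrableOn, intervalIntegral.integral_of_le
      (by linarith [Real.sqrt_nonneg (6 * t)]), ← integral_Icc_eq_integral_Ioc,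
      ← integral_indicator measurableSet_Icc]
    refine integral_congr_ae (Eventually.of_forall fun z => ?_)
    simp only [hiff, Set.indicator_apply, ite_mul, one_mul, zero_mul]
  · have : ∀ z : ℝ, ¬ z ^ 2 / 6 ≤ t := fun z hz => h (le_trans (by positivity) hz)
    simp [this]

theorem tendsto_thresholdMeasure_two (t : ℝ) :
    Tendsto (fun N : ℕ => (thresholdMeasure 2 N).real
      {x | ((√(N : ℝ) : ℝ) : EReal) *
        (mplEstimate (curieWeissTensor 2 N) x - ((1 / 2 : ℝ) : EReal)) ≤ (t : EReal)}) atTop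
      (𝓝 (if 0 ≤ t then quarticCDF √(6 * t) - quarticCDF (-√(6 * t)) else 0)) := by
  classical
  set G : ℕ → ℝ → ℝ := fun N u => if ((√(N : ℝ) : ℝ) : EReal) *
    (meanEstimate 2 u - ((1 / 2 : ℝ) : EReal)) ≤ (t : EReal) then 1 else 0 with hG
  have hker : ∀ z : ℝ, Real.exp (-(1 / 12) * z ^ 4) / √(2 * Real.pi * (1 - (0 : ℝ) ^ 2)) =
      Real.exp (-z ^ 4 / 12) * (√(2 * Real.pi))⁻¹ := fun z => by
    rw [div_eq_mul_inv, show -(1 / 12) * z ^ 4 = -z ^ 4 / 12 by ring,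
      show 2 * Real.pi * (1 - (0 : ℝ) ^ 2) = 2 * Real.pi by ring]
  have hpi : 0 < (√(2 * Real.pi))⁻¹ := by positivity
  have hZ : 0 < ∫ z : ℝ, Real.exp (-z ^ 4 / 12) := integral_exp_pos integrable_exp_neg_quartic
  -- The excluded null set consists of `z = 0`, where the expansion of the ratio is not used, and
  -- the points where the limiting indicator jumps.
  have hae : ∀ᵐ z : ℝ, z ≠ 0 ∧ z ^ 2 / 6 ≠ t := by
    refine ae_ne_zero.and ?_
    have hfin : Set.Finite {z : ℝ | z ^ 2 / 6 = t} := by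
      refine (Set.toFinite {√(6 * t), -√(6 * t)}).subset fun z hz => ?_
      have h1 : z ^ 2 = 6 * t := by
        have : z ^ 2 / 6 = t := hz
        linarith
      rw [← h1, Real.sqrt_sq_eq_abs]
      rcases abs_choice z with h | h <;> simp [h]
    rw [ae_iff]
    simpa using hfin.measure_zero volume
  have key := tendsto_integral_curieWeiss (p := 2) (β := 1 / 2) (q := 4) (by norm_num)
    ⟨2, rfl⟩ (by norm_num) (C := {0}) (κ := fun _ => 1 / 12) (s := fun N : ℕ => √√(N : ℝ))
    (G := G) (M := 1) (f := fun _ z => if z ^ 2 / 6 ≤ t then 1 else 0) (by simp) (by simp)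
    (by simpa only [Finset.mem_singleton, forall_eq] using curieWeissG_two_isLittleO_quartic)
    (by
      intro u hu h0
      have := sq_lt_binaryEntropy hu (by simpa using h0)
      rw [curieWeissG]
      linarith)
    (fun N => Real.sqrt_nonneg _)
    (fun N => by
      rw [show 4 = 2 * 2 by norm_num, pow_mul, Real.sq_sqrt (Real.sqrt_nonneg _),
        Real.sq_sqrt N.cast_nonneg])
    (by
      simp only [Finset.sum_singleton, one_mul, hker, integral_mul_const]
      positivity)
    (fun N u => by rw [hG]; dsimp only; split_ifs <;> simp)
    (by
      simp only [Finset.mem_singleton, forall_eq]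
      filter_upwards [hae] with z hz
      have hlim := tendsto_quarticScale hz.1
      refine tendsto_const_nhds.congr' ?_
      rcases lt_or_gt_of_ne hz.2 with h | h
      · filter_upwards [hlim.eventually (gt_mem_nhds (EReal.coe_lt_coe_iff.2 h))] with a ha
        rw [if_pos h.le, hG]
        exact (if_pos ha.le).symm
      · filter_upwards [hlim.eventually (lt_mem_nhds (EReal.coe_lt_coe_iff.2 h))] with a ha
        rw [if_neg (not_le.2 h), hG]
        exact (if_neg (not_le.2 ha)).symm)
  simp only [Finset.sum_singleton, hker, one_mul, ← mul_assoc, integral_mul_const] at key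
  rw [mul_div_mul_right _ _ hpi.ne', integral_quartic_indicator] at key
  have hval : (if 0 ≤ t then quarticCDF √(6 * t) - quarticCDF (-√(6 * t)) else 0) =
      (if 0 ≤ t then (∫ z in Set.Iic √(6 * t), Real.exp (-z ^ 4 / 12)) -
        ∫ z in Set.Iic (-√(6 * t)), Real.exp (-z ^ 4 / 12) else 0) /
        ∫ z : ℝ, Real.exp (-z ^ 4 / 12) := by
    split_ifs
    · rw [quarticCDF, quarticCDF, sub_div]
    · simp
  rw [hval]
  refine key.congr' ?_
  filter_upwards [eventually_gt_atTop 0] with N hN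
  rw [thresholdMeasure, curieWeissThreshold_two, ← integral_indicator_one (Set.toFinite _).measurableSet]
  refine integral_congr_ae (Eventually.of_forall fun x => ?_)
  simp only [hG, Set.indicator_apply, Set.mem_ofPred_eq, Pi.one_apply,
    mplEstimate_curieWeissTensor le_rfl hN]

end

theorem mainTheorem6 (p : ℕ) (hp : 2 ≤ p) :
    (p = 2 →
      curieWeissThreshold p = 1 / 2 ∧
      ∀ t : ℝ, Tendsto
        (fun N : ℕ => (thresholdMeasure p N).real
          {x | ((√(N : ℝ) : ℝ) : EReal) *
              (mplEstimate (curieWeissTensor p N) x - ((1 / 2 : ℝ) : EReal)) ≤ (t : EReal)})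
        atTop
        (𝓝 (if 0 ≤ t then quarticCDF √(6 * t) - quarticCDF (-√(6 * t)) else 0))) ∧
    (3 ≤ p →
      (∃! m : ℝ, IsPositiveMaximizer p (curieWeissThreshold p) m) ∧
      ∀ m : ℝ, IsPositiveMaximizer p (curieWeissThreshold p) m →
        m < 1 ∧ thresholdCurvature p m < 0 ∧
        TendstoInDistribution
          (fun (N : ℕ) (x : SpinConfig N) => ((√(N : ℝ) : ℝ) : EReal) *
            (mplEstimate (curieWeissTensor p N) x - (curieWeissThreshold p : EReal)))
          atTop (id : EReal → EReal)
          (fun N => thresholdMeasure p N) (sqrtScaleLimit p m) ∧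
        (Even p → TendstoInDistribution
          (fun (N : ℕ) (x : SpinConfig N) =>
            (((N : ℝ) ^ (1 - (p : ℝ) / 2) : ℝ) : EReal) * mplEstimate (curieWeissTensor p N) x)
          atTop (id : EReal → EReal)
          (fun N => thresholdMeasure p N) (fineScaleLimitEven p m)) ∧
        (Odd p → TendstoInDistribution
          (fun (N : ℕ) (x : SpinConfig N) =>
            (((N : ℝ) ^ (1 - (p : ℝ) / 2) : ℝ) : EReal) * mplEstimate (curieWeissTensor p N) x)
          atTop (id : EReal → EReal)
          (fun N => thresholdMeasure p N) (fineScaleLimitOdd p m))) := by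
  refine ⟨?_, fun hp3 => ⟨existsUnique_isPositiveMaximizer hp3, fun m hm => ⟨?_, ?_, ?_, ?_, ?_⟩⟩⟩
  · rintro rfl
    exact ⟨curieWeissThreshold_two, tendsto_thresholdMeasure_two⟩
  · exact hm.lt_one (curieWeissThreshold_spec hp3).1
  · exact thresholdCurvature_neg hp3 hm
  · exact tendstoInDistribution_sqrtScale hp3 hm
  · exact tendstoInDistribution_fineScale_even hp3 hm
  · exact tendstoInDistribution_fineScale_odd hp3 hm
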